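/- Consider a central spin-$1/2$ (Pauli matrices $\tau_x,\tau_y,\tau_z$, $\tau_0=1$, ladder operators $\tau_-=|{\downarrow}\rangle\langle{\uparrow}|$, $\tau_+=\tau_-^\dagger$) and $N$ bath spins-$1/2$ (operators $\sigma^{(k)}_\bullet$, $k=1,\dots,N$). Let $w_x,w_y,w_z,g_0\in\mathbb R$, $\gamma_\downarrow,\gamma_\uparrow\ge 0$ and $0\le\Gamma_\uparrow<\Gamma_\downarrow$; put $\Gamma_\pm=\Gamma_\uparrow\pm\Gamma_\downarrow$, $\varepsilon=-\Gamma_- /\Gamma_+>0$, $S_\pm=\sum_{k=1}^N\sigma_\pm^{(k)}$, $m_z^N=\frac1N\sum_{k=1}^N\sigma_z^{(k)}$, $a_N=S_- /\sqrt{\varepsilon N}$, $a_N^\dagger=S_+/\sqrt{\varepsilon N}$ and $\mathcal W_\nu[X]=\nu^\dagger X\nu-\frac12(\nu^\dagger\nu X+X\nu^\dagger\nu)$. With $g=g_0/\sqrt N$ let $$\mathcal L[X]=i\Big[\sum_{\alpha}w_\alpha\tau_\alpha+g(\tau_+S_-+\tau_-S_+),X\Big]+\mathcal D_\tau[X]+\sum_{k=1}^N\big(\Gamma_\downarrow\mathcal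 W_{\sigma_-^{(k)}}[X]+\Gamma_\uparrow\mathcal W_{\sigma_+^{(k)}}[X]\big),\qquad \mathcal D_\tau=\gamma_\downarrow\mathcal W_{\tau_-}+\gamma_\uparrow\mathcal W_{\tau_+}.$$ Let $\Omega_{\rm SS}$ be the product state of the bath spins in which every bath spin has $\langle\sigma_z\rangle=\Gamma_- /\Gamma_+$ and $\langle\sigma_\pm\rangle=0$, and let $\varphi$ be any state of the central spin. Let $a,a^\dagger$ be the annihilation and creation operators of one bosonic mode, and let $\tilde\Omega_\beta(X)={\rm Tr}(\rho_\beta X)$ be the thermal state $\rho_\beta=(1-e^{-\beta\omega})e^{-\beta\omega a^\dagger a}$ with $e^{-\beta\omega}=\Gamma_\uparrow/(\Gamma_+\varepsilon+\Gamma_\uparrow)$ (the vacuum state if $\Gamma_\uparrow=0$). Let $$\tilde{\mathcal L}[X]=i\Big[\sum_\alpha w_\alpha\tau_\alpha+g_0\sqrt\varepsilon(\tau_-a^\dagger+\tau_+a),X\Big]+\mathcal D_\tau[X]+\kappa_\downarrow\mathcal W_a[X]+\kappa_\uparrow\mathcal W_{a^\dagger}[X],\qquad \kappa_\downarrow=\Gamma_++\frac{\Gamma_\uparrow}{\varepsilon},\quad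 \kappa_\uparrow=\frac{\Gamma_\uparrow}{\varepsilon}.$$ For $\mu=(\alpha,\ell,k,h)$ with $\alpha\in\{0,x,y,z\}$ and $\ell,k,h\in\mathbb N=\{0,1,2,\dots\}$ put $$P_N^\mu=\tau_\alpha a_N^{\dagger\,\ell}a_N^{k}(m_z^N)^h,\qquad P^\mu=\tau_\alpha a^{\dagger\,\ell}a^k(-\varepsilon)^h .$$ Then for all $\nu,\mu,\eta$ the expectation on the right-hand side below is given by absolutely convergent series in the number basis, and $$\lim_{N\to\infty}(\varphi\otimes\Omega_{\rm SS})\big(P_N^\nu\,\mathcal L[P_N^\mu]\,P_N^\eta\big)=(\varphi\otimes\tilde\Omega_\beta)\big(P^\nu\,\tilde{\mathcal L}[P^\mu]\,P^\eta\big).$$ -/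

import Mathlib

open Filter Topology
open scoped ComplexOrder

noncomputable section

namespace CentralSpin

/-! ### Spin one-half operators (basis index `0` is `|↑⟩`, index `1` is `|↓⟩`) -/

/-- Operators on one spin one-half. -/
abbrev SpinMat : Type := Matrix (Fin 2) (Fin 2) ℂ

/-- The identity and the three Pauli matrices: `pauli 0 = 1`, `pauli 1 = σ_x`, `pauli 2 = σ_y`,
`pauli 3 = σ_z`. -/
def pauli : Fin 4 → SpinMat :=
  ![1, !![0, 1; 1, 0], !![0, -Complex.I; Complex.I, 0], !![1, 0; 0, -1]]

/-- The lowering operator `σ_- = |↓⟩⟨↑|`. -/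
def lowering : SpinMat := !![0, 0; 1, 0]

/-- The raising operator `σ_+ = σ_-†`. -/
def raising : SpinMat := lowering.conjTranspose

/-! ### A central spin coupled to an environment with operator algebra `B`

The operators of the composite system form `M₂(ℂ) ⊗ B`, realised as 2×2 matrices over `B`. -/

section Composite

variable {B : Type*} [Ring B] [Algebra ℂ B]

/-- The operator `A ⊗ 1`. -/
def spinOp (A : SpinMat) : Matrix (Fin 2) (Fin 2) B := A.map (algebraMap ℂ B)

/-- The operator `1 ⊗ b`. -/
def envOp (b : B) : Matrix (Fin 2) (Fin 2) B := Matrix.diagonal fun _ => b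

/-- The product functional `φ ⊗ ω`, where `φ(A) = Tr(ρ A)`. -/
def prodState (ρ : SpinMat) (ω : B → ℂ) (X : Matrix (Fin 2) (Fin 2) B) : ℂ :=
  (ρ * X.map ω).trace

/-- `𝒲_ν[X] = ν† X ν - (ν†ν X + X ν†ν)/2`; the adjoint `νd = ν†` is passed explicitly. -/
def dissipator {R : Type*} [Ring R] [Algebra ℂ R] (ν νd X : R) : R :=
  νd * X * ν - (1 / 2 : ℂ) • (νd * ν * X + X * (νd * ν))

/-- `i[H, X]`. -/
def hamPart {R : Type*} [Ring R] [Algebra ℂ R] (H X : R) : R :=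
  Complex.I • (H * X - X * H)

/-- The central-spin Hamiltonian `H_τ = w_x τ_x + w_y τ_y + w_z τ_z`. -/
def hamTau (w : Fin 3 → ℝ) : Matrix (Fin 2) (Fin 2) B :=
  ∑ α : Fin 3, (w α : ℂ) • spinOp (pauli α.succ)

/-- The central-spin dissipator `𝒟_τ = γ_↓ 𝒲_{τ_-} + γ_↑ 𝒲_{τ_+}`. -/
def dissTau (γdown γup : ℝ) (X : Matrix (Fin 2) (Fin 2) B) : Matrix (Fin 2) (Fin 2) B :=
  (γdown : ℂ) • dissipator (spinOp lowering) (spinOp raising) X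
    + (γup : ℂ) • dissipator (spinOp raising) (spinOp lowering) X

/-- The exponents and the Pauli index `(α, ℓ, k, h)` of a monomial. -/
structure MonIdx where
  α : Fin 4
  l : ℕ
  k : ℕ
  h : ℕ

/-- The monomial `τ_α ad^ℓ a^k m^h`. -/
def monom (ad a m : B) (μ : MonIdx) : Matrix (Fin 2) (Fin 2) B :=
  spinOp (pauli μ.α) * envOp (ad ^ μ.l * a ^ μ.k * m ^ μ.h)

end Composite

/-! ### Parameters -/

/-- Parameters of the model: the fields `w_α`, the coupling constant `g₀`, the rates of the central
spin and the rates of the bath spins. -/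
structure Params where
  w : Fin 3 → ℝ
  g₀ : ℝ
  γdown : ℝ
  γup : ℝ
  Γdown : ℝ
  Γup : ℝ

namespace Params

variable (p : Params)

/-- `Γ_+ = Γ_↑ + Γ_↓`. -/
def Γplus : ℝ := p.Γup + p.Γdown

/-- `Γ_- = Γ_↑ - Γ_↓`. -/
def Γminus : ℝ := p.Γup - p.Γdown

/-- `ε = -Ω_SS(σ_z) = -(Γ_- / Γ_+)`. -/
def ε : ℝ := -(p.Γminus / p.Γplus)

end Params

/-! ### The finite system: central spin and `N` bath spins -/

/-- Operators on `N` bath spins, in the product basis. -/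
abbrev BathMat (N : ℕ) : Type := Matrix (Fin N → Fin 2) (Fin N → Fin 2) ℂ

/-- The one-spin operator `A` acting on the `k`-th bath spin. -/
def site {N : ℕ} (k : Fin N) (A : SpinMat) : BathMat N :=
  Matrix.of fun s t => if ∀ j, j ≠ k → s j = t j then A (s k) (t k) else 0

/-- `S_- = ∑ₖ σ_-^{(k)}`. -/
def Sminus (N : ℕ) : BathMat N := ∑ k : Fin N, site k lowering

/-- `S_+ = ∑ₖ σ_+^{(k)}`. -/
def Splus (N : ℕ) : BathMat N := ∑ k : Fin N, site k raising

/-- `m_z^N = (1/N) ∑ₖ σ_z^{(k)}`. -/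
def mz (N : ℕ) : BathMat N := (N : ℂ)⁻¹ • ∑ k : Fin N, site k (pauli 3)

/-- `a_N = S_- / √(εN)`. -/
def aN (p : Params) (N : ℕ) : BathMat N := ((√(p.ε * N) : ℝ) : ℂ)⁻¹ • Sminus N

/-- `a_N† = S_+ / √(εN)`. -/
def adN (p : Params) (N : ℕ) : BathMat N := ((√(p.ε * N) : ℝ) : ℂ)⁻¹ • Splus N

/-- The one-spin density matrix with `⟨σ_z⟩ = Γ_- / Γ_+` and `⟨σ_±⟩ = 0`. -/
def rhoSS (p : Params) : SpinMat :=
  (1 / 2 : ℂ) • (1 + ((p.Γminus / p.Γplus : ℝ) : ℂ) • pauli 3)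

/-- The uncorrelated permutation-invariant state `Ω_SS`, with density matrix `rhoSS ⊗ ⋯ ⊗ rhoSS`. -/
def OmegaSS (p : Params) (N : ℕ) (X : BathMat N) : ℂ :=
  (Matrix.of (fun s t : Fin N → Fin 2 => ∏ k, rhoSS p (s k) (t k)) * X).trace

/-- `H_int = g (τ_+ S_- + τ_- S_+)`. -/
def hamInt (g : ℝ) (N : ℕ) : Matrix (Fin 2) (Fin 2) (BathMat N) :=
  (g : ℂ) • (spinOp raising * envOp (Sminus N) + spinOp lowering * envOp (Splus N))

/-- `𝒟_bath = ∑ₖ (Γ_↓ 𝒲_{σ_-^{(k)}} + Γ_↑ 𝒲_{σ_+^{(k)}})`. -/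
def dissBath (p : Params) (N : ℕ) (X : Matrix (Fin 2) (Fin 2) (BathMat N)) :
    Matrix (Fin 2) (Fin 2) (BathMat N) :=
  ∑ k : Fin N,
    ((p.Γdown : ℂ) • dissipator (envOp (site k lowering)) (envOp (site k raising)) X
      + (p.Γup : ℂ) • dissipator (envOp (site k raising)) (envOp (site k lowering)) X)

/-- The Heisenberg-picture generator `ℒ[X] = i[H_τ + H_int, X] + 𝒟_τ[X] + 𝒟_bath[X]` of the central
spin system with `N` bath spins and coupling strength `g`. -/
def generator (p : Params) (g : ℝ) (N : ℕ) (X : Matrix (Fin 2) (Fin 2) (BathMat N)) :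
    Matrix (Fin 2) (Fin 2) (BathMat N) :=
  hamPart (hamTau p.w + hamInt g N) X + dissTau p.γdown p.γup X + dissBath p N X

/-- The monomial `P_N = τ_α a_N†^ℓ a_N^k (m_z^N)^h`. -/
def monomN (p : Params) (N : ℕ) (μ : MonIdx) : Matrix (Fin 2) (Fin 2) (BathMat N) :=
  monom (adN p N) (aN p N) (mz N) μ

/-! ### The emergent system: one spin and one boson -/

/-- Linear operators on the finite-particle vectors of the bosonic Fock space with number basis
`|n⟩`, a common invariant domain of all polynomials in `a` and `a†`. -/
abbrev BosonOp : Type := Module.End ℂ (ℕ →₀ ℂ)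

/-- The number vector `|n⟩`. -/
def numVec (n : ℕ) : ℕ →₀ ℂ := Finsupp.single n 1

/-- The annihilation operator: `a|n⟩ = √n |n-1⟩` (which is zero for `n = 0`). -/
def aB : BosonOp :=
  Finsupp.linearCombination ℂ fun n : ℕ => ((√(n : ℝ) : ℝ) : ℂ) • numVec (n - 1)

/-- The creation operator: `a†|n⟩ = √(n+1) |n+1⟩`. -/
def adB : BosonOp :=
  Finsupp.linearCombination ℂ fun n : ℕ => ((√((n : ℝ) + 1) : ℝ) : ℂ) • numVec (n + 1)

/-- The Boltzmann factor `e^{-βω} = Γ_↑/(Γ_+ ε + Γ_↑)` (zero temperature if `Γ_↑ = 0`). -/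
def boltzmann (p : Params) : ℝ := p.Γup / (p.Γplus * p.ε + p.Γup)

/-- The term `⟨n|ρ_β X|n⟩` of the trace `Tr(ρ_β X)`, where `ρ_β = (1 - e^{-βω}) e^{-βω a†a}`. -/
def thermalTerm (p : Params) (X : BosonOp) (n : ℕ) : ℂ :=
  (((1 - boltzmann p) * boltzmann p ^ n : ℝ) : ℂ) * (X (numVec n)) n

/-- The thermal state `Ω̃_β(X) = Tr(ρ_β X)`. -/
def OmegaB (p : Params) (X : BosonOp) : ℂ := ∑' n, thermalTerm p X n

/-- The Jaynes–Cummings interaction `H̃_int = g₀ √ε (τ_- a† + τ_+ a)`. -/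
def hamJC (p : Params) : Matrix (Fin 2) (Fin 2) BosonOp :=
  ((p.g₀ * √p.ε : ℝ) : ℂ) • (spinOp lowering * envOp adB + spinOp raising * envOp aB)

/-- The loss rate `κ_↓ = Γ_+ + Γ_↑/ε`. -/
def κdown (p : Params) : ℝ := p.Γplus + p.Γup / p.ε

/-- The pump rate `κ_↑ = Γ_↑/ε`. -/
def κup (p : Params) : ℝ := p.Γup / p.ε

/-- The bosonic dissipator `𝒟̃ = κ_↓ 𝒲_a + κ_↑ 𝒲_{a†}`. -/
def dissBoson (p : Params) (X : Matrix (Fin 2) (Fin 2) BosonOp) :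
    Matrix (Fin 2) (Fin 2) BosonOp :=
  (κdown p : ℂ) • dissipator (envOp aB) (envOp adB) X
    + (κup p : ℂ) • dissipator (envOp adB) (envOp aB) X

/-- The emergent generator `ℒ̃[X] = i[H_τ + H̃_int, X] + 𝒟_τ[X] + 𝒟̃[X]`. -/
def generatorB (p : Params) (X : Matrix (Fin 2) (Fin 2) BosonOp) :
    Matrix (Fin 2) (Fin 2) BosonOp :=
  hamPart (hamTau p.w + hamJC p) X + dissTau p.γdown p.γup X + dissBoson p X

/-- The limiting monomial `P = τ_α a†^ℓ a^k (-ε)^h`. -/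
def monomB (p : Params) (μ : MonIdx) : Matrix (Fin 2) (Fin 2) BosonOp :=
  monom adB aB (algebraMap ℂ BosonOp (-(p.ε : ℂ))) μ

end CentralSpin

end

namespace CentralSpin

/-! ### One-site operators and their sums over the bath -/

section Sites

variable {N : ℕ}

/-! The bath state and the thermal state obey the same exchange rules. With q = Γ_↑/Γ_↓, both
satisfy Ω(X a) = q Ω(a X) and Ω(a† X) = q Ω(X a†), where a stands for a_N on the bath side
(`OmegaSS_mul_aN`, `OmegaSS_adN_mul`, `IsThermal`). Hence (1 - q) Ω(a X) = Ω([a, X]): a leading a,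
and likewise a leading a†, can be traded for a commutator of lower degree. A leading m_z gives -ε
plus 1/N times Ω(∑ σ_- [X, σ_+]) up to a constant (`OmegaSS_mz_mul`); for polynomials X in the
collective operators this expectation is only O(√N). Since [a_N, a_N†] = -m_z/ε has the limit 1,
both sides satisfy the same recursion in the limit, and by induction on the degree it determines
every moment.

The predicate `Emerges` pairs a polynomial in the collective operators with its formal limit. It is
stable under products, under commutators with a_N and a_N† (`Emerges.aN_lie`, `Emerges.lie_adN`),
under N^{-1/2} ∑ s [·, t] (`Emerges.siteComm`) and under the bath dissipator (`Emerges.bathDiss`).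
`Emerges.tendsto` turns it into convergence of expectations.

For the generator, g S_- = g₀ √ε a_N holds exactly. A dissipator fails the Leibniz rule by the cross
term [ν†, X][Y, ν]; summed over the bath spins, this term survives the limit and produces the rates
κ_↓ and κ_↑. -/

theorem site_mul_apply (k : Fin N) (A : SpinMat) (M : BathMat N) (s t : Fin N → Fin 2) :
    (site k A * M) s t = ∑ v, A (s k) v * M (Function.update s k v) t := by
  rw [Matrix.mul_apply]
  symm
  -- Row `s` of a one-site operator is supported on the configurations that differ from `s` at most
  -- at `k`; these are parametrised by their value at `k`.
  refine Fintype.sum_of_injective (fun v => Function.update s k v)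
    (Function.update_injective s k) _ _ ?_ ?_
  · intro u hu
    have : ¬ ∀ j, j ≠ k → s j = u j := by
      intro h
      refine hu ⟨u k, ?_⟩
      funext j
      by_cases hj : j = k
      · subst hj; simp
      · simp [hj, h j hj]
    simp [site, this]
  · intro v
    have : ∀ j, j ≠ k → s j = Function.update s k v j := by
      intro j hj; simp [hj]
    simp only [site, Matrix.of_apply, if_pos this, Function.update_self]

theorem mul_site_apply (k : Fin N) (A : SpinMat) (M : BathMat N) (s t : Fin N → Fin 2) :
    (M * site k A) s t = ∑ v, M s (Function.update t k v) * A v (t k) := by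
  rw [Matrix.mul_apply]
  symm
  refine Fintype.sum_of_injective (fun v => Function.update t k v)
    (Function.update_injective t k) _ _ ?_ ?_
  · intro u hu
    have : ¬ ∀ j, j ≠ k → u j = t j := by
      intro h
      refine hu ⟨u k, ?_⟩
      funext j
      by_cases hj : j = k
      · subst hj; simp
      · simp [hj, h j hj]
    simp [site, this]
  · intro v
    have : ∀ j, j ≠ k → Function.update t k v j = t j := by
      intro j hj; simp [hj]
    simp only [site, Matrix.of_apply, if_pos this, Function.update_self]

theorem site_mul_site (k : Fin N) (A B : SpinMat) : site k A * site k B = site k (A * B) := by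
  ext s t
  rw [site_mul_apply]
  by_cases h : ∀ j, j ≠ k → s j = t j
  · have h' : ∀ v, ∀ j, j ≠ k → Function.update s k v j = t j := by
      intro v j hj; simp [hj, h j hj]
    simp only [site, Matrix.of_apply, if_pos h, if_pos (h' _), Function.update_self,
      Matrix.mul_apply]
  · have h' : ∀ v, ¬ ∀ j, j ≠ k → Function.update s k v j = t j := by
      intro v hv
      refine h fun j hj => ?_
      have := hv j hj
      rwa [Function.update_of_ne hj] at this
    simp only [site, Matrix.of_apply, if_neg h, if_neg (h' _), mul_zero, Finset.sum_const_zero]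

theorem site_commute {j k : Fin N} (hjk : j ≠ k) (A B : SpinMat) :
    site k A * site j B = site j B * site k A := by
  ext s t
  rw [site_mul_apply, mul_site_apply, Finset.sum_eq_single (t k), Finset.sum_eq_single (s k)]
  · have h1 : (∀ i, i ≠ j → Function.update s k (t k) i = t i) ↔
        ∀ i, i ≠ j → s i = Function.update t k (s k) i := by
      refine forall_congr' fun i => forall_congr' fun _ => ?_
      by_cases hi : i = k
      · subst hi; simp
      · simp [hi]
    simp only [site, Matrix.of_apply, Function.update_of_ne hjk]
    by_cases h : ∀ i, i ≠ j → s i = Function.update t k (s k) i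
    · rw [if_pos h, if_pos (h1.2 h), mul_comm]
    · rw [if_neg h, if_neg (mt h1.1 h), mul_zero, zero_mul]
  · intro v _ hv
    have : ¬ ∀ i, i ≠ j → s i = Function.update t k v i := by
      intro h
      have := h k hjk.symm
      simp only [Function.update_self] at this
      exact hv this.symm
    simp only [site, Matrix.of_apply, if_neg this, zero_mul]
  · simp
  · intro v _ hv
    have : ¬ ∀ i, i ≠ j → Function.update s k v i = t i := by
      intro h
      have := h k hjk.symm
      simp only [Function.update_self] at this
      exact hv this
    simp only [site, Matrix.of_apply, if_neg this, mul_zero]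
  · simp

theorem site_add (k : Fin N) (A B : SpinMat) : site k (A + B) = site k A + site k B := by
  ext s t
  simp only [site, Matrix.of_apply, Matrix.add_apply]
  split_ifs <;> simp

theorem site_smul (k : Fin N) (c : ℂ) (A : SpinMat) : site k (c • A) = c • site k A := by
  ext s t
  simp only [site, Matrix.of_apply, Matrix.smul_apply]
  split_ifs <;> simp

theorem site_sub (k : Fin N) (A B : SpinMat) : site k (A - B) = site k A - site k B := by
  ext s t
  simp only [site, Matrix.of_apply, Matrix.sub_apply]
  split_ifs <;> simp

theorem site_zero (k : Fin N) : site k 0 = 0 := by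
  ext s t
  simp [site]

theorem site_one (k : Fin N) : site k 1 = 1 := by
  ext s t
  simp only [site, Matrix.of_apply, Matrix.one_apply]
  by_cases h : s = t
  · subst h; simp
  · rw [if_neg h]
    by_cases hk : s k = t k
    · rw [if_neg]
      intro h'
      refine h (funext fun j => ?_)
      by_cases hj : j = k
      · rw [hj, hk]
      · exact h' j hj
    · simp [hk]

/-- The collective operator `∑ₖ A^{(k)}`. -/
noncomputable def siteSum (N : ℕ) (A : SpinMat) : BathMat N := ∑ k : Fin N, site k A

theorem siteSum_add (A B : SpinMat) : siteSum N (A + B) = siteSum N A + siteSum N B := by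
  simp only [siteSum, site_add, Finset.sum_add_distrib]

theorem siteSum_smul (c : ℂ) (A : SpinMat) : siteSum N (c • A) = c • siteSum N A := by
  simp only [siteSum, site_smul, Finset.smul_sum]

theorem siteSum_one : siteSum N 1 = (N : ℂ) • 1 := by
  simp only [siteSum, site_one, Finset.sum_const, Finset.card_univ, Fintype.card_fin]
  rw [Nat.cast_smul_eq_nsmul]

/-- Operators on different sites commute, so only the summand at `k` survives. This locality is the
source of all later commutation relations. -/
theorem siteSum_mul_site (k : Fin N) (A B : SpinMat) :
    siteSum N A * site k B - site k B * siteSum N A = site k (A * B - B * A) := by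
  simp only [siteSum, Finset.sum_mul, Finset.mul_sum, ← Finset.sum_sub_distrib]
  rw [Finset.sum_eq_single k]
  · rw [site_mul_site, site_mul_site, site_sub]
  · intro j _ hj
    rw [site_commute hj.symm, sub_self]
  · simp

theorem site_mul_siteSum (k : Fin N) (A B : SpinMat) :
    site k B * siteSum N A - siteSum N A * site k B = site k (B * A - A * B) := by
  rw [← neg_sub (siteSum N A * site k B), siteSum_mul_site, site_sub, site_sub, neg_sub]

theorem lie_siteSum (A B : SpinMat) :
    ⁅siteSum N A, siteSum N B⁆ = siteSum N (A * B - B * A) := by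
  conv_lhs => rw [siteSum.eq_1 N B, Ring.lie_def]
  rw [Finset.mul_sum, Finset.sum_mul, ← Finset.sum_sub_distrib, siteSum]
  exact Finset.sum_congr rfl fun k _ => siteSum_mul_site k A B

/-- The sum `∑ₖ s^{(k)} [X, t^{(k)}]`. -/
noncomputable def siteComm (s t : SpinMat) (X : BathMat N) : BathMat N :=
  ∑ k : Fin N, site k s * (X * site k t - site k t * X)

theorem siteComm_add (s t : SpinMat) (X Y : BathMat N) :
    siteComm s t (X + Y) = siteComm s t X + siteComm s t Y := by
  simp only [siteComm, ← Finset.sum_add_distrib]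
  exact Finset.sum_congr rfl fun k _ => by noncomm_ring

theorem siteComm_smul (s t : SpinMat) (c : ℂ) (X : BathMat N) :
    siteComm s t (c • X) = c • siteComm s t X := by
  simp only [siteComm, Finset.smul_sum, smul_mul_assoc, mul_smul_comm, ← smul_sub]

theorem siteComm_one (s t : SpinMat) : siteComm s t (1 : BathMat N) = 0 := by
  simp [siteComm]

/-- Leibniz rule for the commutator with `t` at each site, after which the factor `s` is moved past
the collective operator. The move costs a commutator at the same site, which is why `s` changes in
the last term. -/
theorem siteComm_siteSum_mul (s t A : SpinMat) (X : BathMat N) :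
    siteComm s t (siteSum N A * X) =
      siteSum N (s * (A * t - t * A)) * X + siteSum N A * siteComm s t X
        + siteComm (s * A - A * s) t X := by
  rw [siteComm, siteComm, siteComm, siteSum.eq_1 N (s * _), Finset.sum_mul, Finset.mul_sum,
    ← Finset.sum_add_distrib, ← Finset.sum_add_distrib]
  refine Finset.sum_congr rfl fun k _ => ?_
  have h1 := siteSum_mul_site k A t
  rw [← site_mul_siteSum, ← site_mul_site, ← h1]
  noncomm_ring

end Sites

/-! ### Commutators and dissipators -/

theorem mul_lie_ring {R : Type*} [Ring R] (x y z : R) : ⁅x * y, z⁆ = x * ⁅y, z⁆ + ⁅x, z⁆ * y := by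
  simp only [Ring.lie_def]
  noncomm_ring

theorem lie_mul_ring {R : Type*} [Ring R] (x y z : R) : ⁅z, x * y⁆ = x * ⁅z, y⁆ + ⁅z, x⁆ * y := by
  simp only [Ring.lie_def]
  noncomm_ring

theorem lie_self_ring {R : Type*} [Ring R] (x : R) : ⁅x, x⁆ = 0 := by
  simp [Ring.lie_def]

theorem lie_skew_ring {R : Type*} [Ring R] (x y : R) : ⁅x, y⁆ = -⁅y, x⁆ := by
  simp [Ring.lie_def]

theorem add_lie_ring {R : Type*} [Ring R] (x y z : R) : ⁅x + y, z⁆ = ⁅x, z⁆ + ⁅y, z⁆ := by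
  simp only [Ring.lie_def]
  noncomm_ring

theorem lie_add_ring {R : Type*} [Ring R] (x y z : R) : ⁅z, x + y⁆ = ⁅z, x⁆ + ⁅z, y⁆ := by
  simp only [Ring.lie_def]
  noncomm_ring

theorem smul_lie_ring {R : Type*} [Ring R] [Algebra ℂ R] (c : ℂ) (x y : R) :
    ⁅c • x, y⁆ = c • ⁅x, y⁆ := by
  simp only [Ring.lie_def, smul_mul_assoc, mul_smul_comm, smul_sub]

theorem lie_smul_ring {R : Type*} [Ring R] [Algebra ℂ R] (c : ℂ) (x y : R) :
    ⁅x, c • y⁆ = c • ⁅x, y⁆ := by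
  simp only [Ring.lie_def, smul_mul_assoc, mul_smul_comm, smul_sub]

theorem zero_lie_ring {R : Type*} [Ring R] (x : R) : ⁅(0 : R), x⁆ = 0 := by
  simp [Ring.lie_def]

theorem lie_zero_ring {R : Type*} [Ring R] (x : R) : ⁅x, (0 : R)⁆ = 0 := by
  simp [Ring.lie_def]

theorem one_lie_ring {R : Type*} [Ring R] (x : R) : ⁅(1 : R), x⁆ = 0 := by
  simp [Ring.lie_def]

theorem lie_one_ring {R : Type*} [Ring R] (x : R) : ⁅x, (1 : R)⁆ = 0 := by
  simp [Ring.lie_def]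

/-- The last term measures the failure of the Leibniz rule. -/
theorem dissipator_mul {R : Type*} [Ring R] [Algebra ℂ R] (ν νd X Y : R) :
    dissipator ν νd (X * Y) = dissipator ν νd X * Y + X * dissipator ν νd Y
      + ⁅νd, X⁆ * ⁅Y, ν⁆ := by
  simp only [dissipator, Ring.lie_def, sub_mul, mul_sub, add_mul, mul_add, smul_add, smul_mul_assoc,
    mul_smul_comm, mul_assoc]
  module

theorem dissipator_add {R : Type*} [Ring R] [Algebra ℂ R] (ν νd X Y : R) :
    dissipator ν νd (X + Y) = dissipator ν νd X + dissipator ν νd Y := by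
  simp only [dissipator, add_mul, mul_add, smul_add]
  abel

theorem dissipator_smul {R : Type*} [Ring R] [Algebra ℂ R] (ν νd X : R) (c : ℂ) :
    dissipator ν νd (c • X) = c • dissipator ν νd X := by
  simp only [dissipator, smul_add, smul_sub, smul_mul_assoc, mul_smul_comm]
  module

theorem dissipator_one {R : Type*} [Ring R] [Algebra ℂ R] (ν νd : R) :
    dissipator ν νd 1 = 0 := by
  simp only [dissipator, mul_one, one_mul]
  module

theorem dissipator_site_siteSum {N : ℕ} (k : Fin N) (ν νd A : SpinMat) :
    dissipator (site k ν) (site k νd) (siteSum N A) = site k (dissipator ν νd A) := by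
  -- Written through the commutators with ν and ν†, the dissipator inherits locality: each
  -- commutator of a collective operator with a one-site operator lives on that site.
  have h : ∀ R : SpinMat, dissipator ν νd R =
      (1 / 2 : ℂ) • (νd * (R * ν - ν * R) - (R * νd - νd * R) * ν) := by
    intro R
    simp only [dissipator, sub_mul, mul_sub, smul_sub, smul_add, mul_assoc]
    module
  have h' : dissipator (site k ν) (site k νd) (siteSum N A) =
      (1 / 2 : ℂ) • (site k νd * (siteSum N A * site k ν - site k ν * siteSum N A)
        - (siteSum N A * site k νd - site k νd * siteSum N A) * site k ν) := by
    simp only [dissipator, sub_mul, mul_sub, smul_sub, smul_add, mul_assoc]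
    module
  rw [h, h', siteSum_mul_site, siteSum_mul_site, site_mul_site, site_mul_site, site_smul, site_sub]

/-- The bath dissipator on the bath algebra. -/
noncomputable def bathDiss (p : Params) {N : ℕ} (X : BathMat N) : BathMat N :=
  ∑ k : Fin N,
    ((p.Γdown : ℂ) • dissipator (site k lowering) (site k raising) X
      + (p.Γup : ℂ) • dissipator (site k raising) (site k lowering) X)

theorem bathDiss_add (p : Params) {N : ℕ} (X Y : BathMat N) :
    bathDiss p (X + Y) = bathDiss p X + bathDiss p Y := by
  simp only [bathDiss, dissipator_add, ← Finset.sum_add_distrib, smul_add]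
  exact Finset.sum_congr rfl fun k _ => by abel

theorem bathDiss_smul (p : Params) {N : ℕ} (c : ℂ) (X : BathMat N) :
    bathDiss p (c • X) = c • bathDiss p X := by
  simp only [bathDiss, dissipator_smul, Finset.smul_sum]
  exact Finset.sum_congr rfl fun k _ => by module

theorem bathDiss_one (p : Params) {N : ℕ} : bathDiss p (1 : BathMat N) = 0 := by
  simp [bathDiss, dissipator_one]

/-- The three groups of terms are those of `dissipator_mul`, summed over sites; by locality the
cross terms become `siteComm` sums. -/
theorem bathDiss_siteSum_mul (p : Params) {N : ℕ} (A : SpinMat) (X : BathMat N) :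
    bathDiss p (siteSum N A * X) =
      siteSum N ((p.Γdown : ℂ) • dissipator lowering raising A
        + (p.Γup : ℂ) • dissipator raising lowering A) * X + siteSum N A * bathDiss p X
      + ((p.Γdown : ℂ) • siteComm (raising * A - A * raising) lowering X
        + (p.Γup : ℂ) • siteComm (lowering * A - A * lowering) raising X) := by
  simp only [bathDiss, siteComm, Finset.smul_sum, Finset.mul_sum]
  rw [siteSum.eq_1 N (_ + _), Finset.sum_mul, ← Finset.sum_add_distrib, ← Finset.sum_add_distrib,
    ← Finset.sum_add_distrib]
  refine Finset.sum_congr rfl fun k _ => ?_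
  rw [← site_mul_siteSum, ← site_mul_siteSum, dissipator_mul, dissipator_mul, dissipator_site_siteSum, dissipator_site_siteSum,
    site_add, site_smul, site_smul]
  simp only [Ring.lie_def, smul_add, mul_add, add_mul, smul_mul_assoc, mul_smul_comm]
  abel

/-! ### The stationary state of the bath -/

/-- The ratio of the populations of the two levels of a bath spin in the stationary state. -/
noncomputable def levelRatio (p : Params) : ℂ := (boltzmann p : ℂ)

/-- The rates allow for the emergent boson: `0 ≤ Γ_↑ < Γ_↓`. -/
structure Params.Admissible (p : Params) : Prop where
  up_nonneg : 0 ≤ p.Γup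
  up_lt_down : p.Γup < p.Γdown

namespace Params.Admissible

variable {p : Params} (hp : p.Admissible)
include hp

theorem down_pos : 0 < p.Γdown := hp.up_nonneg.trans_lt hp.up_lt_down

theorem plus_pos : 0 < p.Γplus := add_pos_of_nonneg_of_pos hp.up_nonneg hp.down_pos

theorem plus_mul_ε : p.Γplus * p.ε = p.Γdown - p.Γup := by
  have := hp.plus_pos.ne'
  rw [Params.ε, Params.Γminus]
  field_simp
  ring

theorem ε_pos : 0 < p.ε := by
  have h := hp.plus_mul_ε
  have h2 := sub_pos.2 hp.up_lt_down
  rw [← h] at h2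
  exact (mul_pos_iff_of_pos_left hp.plus_pos).1 h2

theorem boltzmann_eq : boltzmann p = p.Γup / p.Γdown := by
  rw [boltzmann, hp.plus_mul_ε, sub_add_cancel]

theorem boltzmann_nonneg : 0 ≤ boltzmann p := by
  rw [hp.boltzmann_eq]
  exact div_nonneg hp.up_nonneg hp.down_pos.le

theorem boltzmann_lt_one : boltzmann p < 1 := by
  rw [hp.boltzmann_eq, div_lt_one hp.down_pos]
  exact hp.up_lt_down

end Params.Admissible

section State

variable {p : Params} {N : ℕ}

/-- The populations of the two levels of a bath spin. -/
noncomputable def population (p : Params) : Fin 2 → ℂ :=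
  ![((p.Γup / p.Γplus : ℝ) : ℂ), ((p.Γdown / p.Γplus : ℝ) : ℂ)]

theorem rhoSS_eq (hp : p.Admissible) : rhoSS p = Matrix.diagonal (population p) := by
  have h : (p.Γplus : ℂ) ≠ 0 := by exact_mod_cast hp.plus_pos.ne'
  have h' : (p.Γup : ℂ) + p.Γdown ≠ 0 := by
    rw [Params.Γplus] at h; exact_mod_cast h
  ext i j
  fin_cases i <;> fin_cases j <;>
    simp [rhoSS, pauli, population, Params.Γminus, Params.Γplus] <;> field_simp <;> ring

theorem population_raising (hp : p.Admissible) (i j : Fin 2) :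
    population p i * raising i j = levelRatio p * (raising i j * population p j) := by
  have h : (p.Γplus : ℂ) ≠ 0 := by exact_mod_cast hp.plus_pos.ne'
  have h' : (p.Γdown : ℂ) ≠ 0 := by exact_mod_cast hp.down_pos.ne'
  rw [levelRatio, hp.boltzmann_eq]
  fin_cases i <;> fin_cases j <;>
    simp [population, raising, lowering, Matrix.conjTranspose_apply]
  field_simp

theorem population_lowering (hp : p.Admissible) (i j : Fin 2) :
    lowering i j * population p j = levelRatio p * (population p i * lowering i j) := by
  have h : (p.Γplus : ℂ) ≠ 0 := by exact_mod_cast hp.plus_pos.ne'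
  have h' : (p.Γdown : ℂ) ≠ 0 := by exact_mod_cast hp.down_pos.ne'
  rw [levelRatio, hp.boltzmann_eq]
  fin_cases i <;> fin_cases j <;>
    simp [population, lowering]
  field_simp

/-- The density matrix of the bath in the stationary state. -/
noncomputable def bathDensity (p : Params) (N : ℕ) : BathMat N :=
  Matrix.diagonal fun s : Fin N → Fin 2 => ∏ k, population p (s k)

theorem OmegaSS_eq (hp : p.Admissible) (X : BathMat N) :
    OmegaSS p N X = (bathDensity p N * X).trace := by
  rw [OmegaSS, rhoSS_eq hp]
  congr 2
  ext s t
  simp only [Matrix.of_apply, bathDensity, Matrix.diagonal_apply]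
  by_cases h : s = t
  · subst h; simp
  · rw [if_neg h]
    obtain ⟨k, hk⟩ := Function.ne_iff.1 h
    exact Finset.prod_eq_zero (Finset.mem_univ k) (if_neg hk)

theorem OmegaSS_add (X Y : BathMat N) :
    OmegaSS p N (X + Y) = OmegaSS p N X + OmegaSS p N Y := by
  simp [OmegaSS, mul_add]

theorem OmegaSS_sub (X Y : BathMat N) :
    OmegaSS p N (X - Y) = OmegaSS p N X - OmegaSS p N Y := by
  simp [OmegaSS, mul_sub]

theorem OmegaSS_smul (c : ℂ) (X : BathMat N) : OmegaSS p N (c • X) = c * OmegaSS p N X := by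
  simp [OmegaSS]

theorem OmegaSS_sum {ι : Type*} (S : Finset ι) (X : ι → BathMat N) :
    OmegaSS p N (∑ i ∈ S, X i) = ∑ i ∈ S, OmegaSS p N (X i) := by
  simp [OmegaSS, Finset.mul_sum, Matrix.trace_sum]

theorem OmegaSS_one (hp : p.Admissible) : OmegaSS p N 1 = 1 := by
  have h : (p.Γup : ℂ) + p.Γdown ≠ 0 := by
    have := hp.plus_pos.ne'
    rw [Params.Γplus] at this; exact_mod_cast this
  have h1 : ∑ i, population p i = 1 := by
    simp only [population, Fin.sum_univ_two, Matrix.cons_val_zero, Matrix.cons_val_one,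
      Params.Γplus]
    push_cast
    field_simp
  rw [OmegaSS_eq hp, mul_one, bathDensity, Matrix.trace_diagonal]
  -- The trace of the product density is a sum over configurations of products, that is, a product
  -- over sites of the total population 1.
  have := Finset.prod_univ_sum (fun _ : Fin N => (Finset.univ : Finset (Fin 2)))
    (fun _ i => population p i)
  rw [Fintype.piFinset_univ] at this
  rw [← this]
  simp [h1]

theorem bathDensity_mul_raising (hp : p.Admissible) (k : Fin N) :
    bathDensity p N * site k raising = levelRatio p • (site k raising * bathDensity p N) := by
  ext s t
  rw [bathDensity, Matrix.smul_apply, Matrix.diagonal_mul, Matrix.mul_diagonal]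
  simp only [site, Matrix.of_apply, smul_eq_mul]
  split_ifs with h
  -- Away from `k` the two configurations agree, so the remaining populations form a common factor
  -- and the one-site identity suffices.
  · rw [← Finset.mul_prod_erase _ _ (Finset.mem_univ k),
      ← Finset.mul_prod_erase _ (fun k => population p (t k)) (Finset.mem_univ k),
      Finset.prod_congr rfl fun j hj => by rw [h j (Finset.ne_of_mem_erase hj)]]
    linear_combination (∏ j ∈ Finset.univ.erase k, population p (t j)) *
      population_raising hp (s k) (t k)
  · simp

theorem lowering_mul_bathDensity (hp : p.Admissible) (k : Fin N) :
    site k lowering * bathDensity p N = levelRatio p • (bathDensity p N * site k lowering) := by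
  ext s t
  rw [bathDensity, Matrix.smul_apply, Matrix.diagonal_mul, Matrix.mul_diagonal]
  simp only [site, Matrix.of_apply, smul_eq_mul]
  split_ifs with h
  · rw [← Finset.mul_prod_erase _ (fun k => population p (s k)) (Finset.mem_univ k),
      ← Finset.mul_prod_erase _ (fun k => population p (t k)) (Finset.mem_univ k),
      Finset.prod_congr rfl fun j hj => show population p (s j) = population p (t j) by rw [h j (Finset.ne_of_mem_erase hj)]]
    linear_combination (∏ j ∈ Finset.univ.erase k, population p (t j)) *
      population_lowering hp (s k) (t k)
  · simp

/-- Cyclicity of the trace together with the exchange relation for the density matrix: a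
detailed-balance identity at one site. -/
theorem OmegaSS_raising_mul (hp : p.Admissible) (k : Fin N) (X : BathMat N) :
    OmegaSS p N (site k raising * X) = levelRatio p * OmegaSS p N (X * site k raising) := by
  rw [OmegaSS_eq hp, OmegaSS_eq hp, ← mul_assoc, bathDensity_mul_raising hp, smul_mul_assoc,
    Matrix.trace_smul, smul_eq_mul, mul_assoc, Matrix.trace_mul_comm, mul_assoc]

theorem OmegaSS_mul_lowering (hp : p.Admissible) (k : Fin N) (X : BathMat N) :
    OmegaSS p N (X * site k lowering) = levelRatio p * OmegaSS p N (site k lowering * X) := by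
  rw [OmegaSS_eq hp, OmegaSS_eq hp, ← mul_assoc, Matrix.trace_mul_comm, ← mul_assoc,
    lowering_mul_bathDensity hp, smul_mul_assoc, Matrix.trace_smul, smul_eq_mul, mul_assoc]

theorem OmegaSS_adN_mul (hp : p.Admissible) (X : BathMat N) :
    OmegaSS p N (adN p N * X) = levelRatio p * OmegaSS p N (X * adN p N) := by
  simp only [adN, Splus, smul_mul_assoc, mul_smul_comm, OmegaSS_smul, Finset.sum_mul,
    Finset.mul_sum, OmegaSS_sum, OmegaSS_raising_mul hp]
  exact Finset.sum_congr rfl fun k _ => by ring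

theorem OmegaSS_mul_aN (hp : p.Admissible) (X : BathMat N) :
    OmegaSS p N (X * aN p N) = levelRatio p * OmegaSS p N (aN p N * X) := by
  simp only [aN, Sminus, smul_mul_assoc, mul_smul_comm, OmegaSS_smul, Finset.sum_mul,
    Finset.mul_sum, OmegaSS_sum, OmegaSS_mul_lowering hp]
  exact Finset.sum_congr rfl fun k _ => by ring

/-- At each site, σ_+σ_- = (1 + σ_z)/2 and σ_-σ_+ = (1 - σ_z)/2. Exchanging σ_+ turns Ω(σ_+σ_-X)
into q Ω(σ_-Xσ_+), and solving for Ω(σ_z X) gives the mean (q - 1)/(1 + q) = -ε plus a commutator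
correction. -/
theorem OmegaSS_mz_mul (hp : p.Admissible) (hN : N ≠ 0) (X : BathMat N) :
    OmegaSS p N (mz N * X) = -p.ε * OmegaSS p N X
      + 2 * levelRatio p / (1 + levelRatio p) *
        ((N : ℂ)⁻¹ * OmegaSS p N (siteComm lowering raising X)) := by
  have hd : (p.Γdown : ℂ) ≠ 0 := by exact_mod_cast hp.down_pos.ne'
  have hpl : (p.Γup : ℂ) + p.Γdown ≠ 0 := by
    have := hp.plus_pos.ne'
    rw [Params.Γplus] at this; exact_mod_cast this
  have hpl' : (p.Γdown : ℂ) + p.Γup ≠ 0 := by rwa [add_comm]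
  have hq : levelRatio p = p.Γup / p.Γdown := by rw [levelRatio, hp.boltzmann_eq]; push_cast; rfl
  have hε : (p.ε : ℂ) = (p.Γdown - p.Γup) / (p.Γup + p.Γdown) := by
    rw [Params.ε, Params.Γminus, Params.Γplus]; push_cast; ring
  have hq1 : 1 + levelRatio p ≠ 0 := by
    rw [hq, one_add_div hd]
    exact div_ne_zero hpl' hd
  have key : ∀ k : Fin N, OmegaSS p N (site k (pauli 3) * X) = -p.ε * OmegaSS p N X
      + 2 * levelRatio p / (1 + levelRatio p) *
        OmegaSS p N (site k lowering * (X * site k raising - site k raising * X)) := by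
    intro k
    have e1 : raising * lowering = (1 / 2 : ℂ) • (1 + pauli 3) := by
      ext i j; fin_cases i <;> fin_cases j <;>
        simp [raising, lowering, pauli, Matrix.mul_apply, Matrix.conjTranspose_apply]; norm_num
    have e2 : lowering * raising = (1 / 2 : ℂ) • (1 - pauli 3) := by
      ext i j; fin_cases i <;> fin_cases j <;>
        simp [raising, lowering, pauli, Matrix.mul_apply, Matrix.conjTranspose_apply]; norm_num
    have h1 := OmegaSS_raising_mul hp k (site k lowering * X)
    rw [← mul_assoc, site_mul_site, e1, site_smul, site_add, site_one, smul_mul_assoc,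
      OmegaSS_smul, add_mul, one_mul, OmegaSS_add] at h1
    rw [mul_sub, ← mul_assoc, ← mul_assoc, site_mul_site, e2, site_smul, site_sub, site_one,
      smul_mul_assoc, OmegaSS_sub, OmegaSS_smul, sub_mul, one_mul, OmegaSS_sub]
    have hε' : (p.ε : ℂ) = (1 - levelRatio p) / (1 + levelRatio p) := by
      rw [hε, hq]; field_simp; rw [add_comm]
    rw [hε']
    field_simp
    linear_combination 2 * h1
  have hN' : (N : ℂ) ≠ 0 := by exact_mod_cast hN
  simp only [mz, siteComm, smul_mul_assoc, OmegaSS_smul, Finset.sum_mul, OmegaSS_sum, key,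
    Finset.sum_add_distrib, Finset.sum_const, Finset.card_univ, Fintype.card_fin, nsmul_eq_mul,
    ← Finset.mul_sum]
  field_simp

end State

/-! ### The boson -/

section Boson

theorem aB_numVec (n : ℕ) : aB (numVec n) = ((√(n : ℝ) : ℝ) : ℂ) • numVec (n - 1) := by
  rw [aB, numVec, Finsupp.linearCombination_single, one_smul]

theorem adB_numVec (n : ℕ) : adB (numVec n) = ((√((n : ℝ) + 1) : ℝ) : ℂ) • numVec (n + 1) := by
  rw [adB, numVec, Finsupp.linearCombination_single, one_smul]

theorem bosonOp_ext {X Y : BosonOp} (h : ∀ n, X (numVec n) = Y (numVec n)) : X = Y :=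
  Finsupp.lhom_ext' fun n => LinearMap.ext_ring (h n)

theorem lie_aB_adB : ⁅aB, adB⁆ = 1 := by
  refine bosonOp_ext fun n => ?_
  have hs : ∀ x : ℝ, 0 ≤ x → ((√x : ℝ) : ℂ) * ((√x : ℝ) : ℂ) = x := by
    intro x hx; rw [← Complex.ofReal_mul, Real.mul_self_sqrt hx]
  rw [Ring.lie_def, LinearMap.sub_apply, Module.End.mul_apply, Module.End.mul_apply, adB_numVec,
    aB_numVec,
    map_smul, map_smul, aB_numVec, Module.End.one_apply, smul_smul, Nat.add_sub_cancel]
  push_cast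
  rw [hs _ (by positivity)]
  -- At n = 0 the truncated index `n - 1` is harmless, because its coefficient √0 vanishes.
  rcases n with _ | n
  · simp
  · rw [Nat.add_sub_cancel, adB_numVec, smul_smul]
    push_cast
    rw [hs _ (by positivity)]
    push_cast
    module

/-- Reads off coefficients when the operator stands leftmost inside a diagonal matrix element. -/
theorem aB_apply (f : ℕ →₀ ℂ) (n : ℕ) : (aB f) n = ((√((n : ℝ) + 1) : ℝ) : ℂ) * f (n + 1) := by
  induction f using Finsupp.induction_linear with
  | zero => simp
  | add f g hf hg => rw [map_add, Finsupp.add_apply, hf, hg, Finsupp.add_apply, mul_add]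
  | single m c =>
    have : (Finsupp.single m c : ℕ →₀ ℂ) = c • numVec m := by simp [numVec]
    rw [this, map_smul, aB_numVec]
    rcases m with _ | m
    · simp [numVec]
    · by_cases h : m = n
      · subst h; simp [numVec]; ring
      · simp [numVec, h]

theorem adB_apply_zero (f : ℕ →₀ ℂ) : (adB f) 0 = 0 := by
  induction f using Finsupp.induction_linear with
  | zero => simp
  | add f g hf hg => rw [map_add, Finsupp.add_apply, hf, hg, add_zero]
  | single m c =>
    have : (Finsupp.single m c : ℕ →₀ ℂ) = c • numVec m := by simp [numVec]
    rw [this, map_smul, adB_numVec]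
    simp [numVec]

theorem adB_apply_succ (f : ℕ →₀ ℂ) (n : ℕ) :
    (adB f) (n + 1) = ((√((n : ℝ) + 1) : ℝ) : ℂ) * f n := by
  induction f using Finsupp.induction_linear with
  | zero => simp
  | add f g hf hg => rw [LinearMap.map_add, Finsupp.add_apply _ _ (n + 1), hf, hg, Finsupp.add_apply, mul_add]
  | single m c =>
    have : (Finsupp.single m c : ℕ →₀ ℂ) = c • numVec m := by simp [numVec]
    rw [this, map_smul, adB_numVec]
    by_cases h : m = n
    · subst h; simp [numVec]; ring
    · simp [numVec, h]

variable (p : Params)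

theorem thermalTerm_add (X Y : BosonOp) :
    thermalTerm p (X + Y) = thermalTerm p X + thermalTerm p Y := by
  funext n; simp [thermalTerm, mul_add]

theorem thermalTerm_smul (c : ℂ) (X : BosonOp) :
    thermalTerm p (c • X) = fun n => c * thermalTerm p X n := by
  funext n; simp [thermalTerm]; ring

theorem thermalTerm_mul_aB_zero (X : BosonOp) : thermalTerm p (X * aB) 0 = 0 := by
  simp [thermalTerm, aB_numVec]

/-- The exchange rule holds term by term once the index is shifted by one, so it can be used before
convergence is known. -/
theorem thermalTerm_mul_aB_succ (X : BosonOp) (n : ℕ) :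
    thermalTerm p (X * aB) (n + 1) = levelRatio p * thermalTerm p (aB * X) n := by
  simp only [thermalTerm, Module.End.mul_apply, aB_numVec, aB_apply, map_smul,
    Finsupp.smul_apply, smul_eq_mul, levelRatio, Nat.add_sub_cancel]
  push_cast
  ring

theorem thermalTerm_adB_mul_zero (X : BosonOp) : thermalTerm p (adB * X) 0 = 0 := by
  simp [thermalTerm, adB_apply_zero]

theorem thermalTerm_adB_mul_succ (X : BosonOp) (n : ℕ) :
    thermalTerm p (adB * X) (n + 1) = levelRatio p * thermalTerm p (X * adB) n := by
  simp only [thermalTerm, Module.End.mul_apply, adB_numVec, adB_apply_succ, map_smul,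
    Finsupp.smul_apply, smul_eq_mul, levelRatio]
  push_cast
  ring

/-- A sequence with `t₀ = u₀` and `tₙ₊₁ = q tₙ + uₙ₊₁`, where `u` is summable and `|q| < 1`. -/
theorem hasSum_of_linear_recurrence {q : ℂ} (hq : ‖q‖ < 1) {t u : ℕ → ℂ} (h0 : t 0 = u 0)
    (h : ∀ n, t (n + 1) = q * t n + u (n + 1)) (hu : Summable u) :
    HasSum t ((1 - q)⁻¹ * ∑' n, u n) := by
  have hq1 : 1 - q ≠ 0 := by
    intro h'
    rw [← sub_eq_zero.1 h'] at hq
    simp at hq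
  -- With Sₙ the partial sums of norms and U the total of ‖u‖, the recurrence gives Sₙ ≤ Sₙ₊₁ ≤ ‖q‖
  -- Sₙ + U, hence the uniform bound U/(1 - ‖q‖).
  have hs : Summable t := by
    refine Summable.of_norm (summable_of_sum_range_le (c := (∑' n, ‖u n‖) / (1 - ‖q‖))
      (fun _ => norm_nonneg _) fun n => ?_)
    rw [le_div_iff₀ (by linarith)]
    have key : ∀ n, ∑ i ∈ Finset.range (n + 1), ‖t i‖ ≤
        ‖q‖ * ∑ i ∈ Finset.range n, ‖t i‖ + ∑ i ∈ Finset.range (n + 1), ‖u i‖ := by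
      intro n
      rw [Finset.sum_range_succ', Finset.sum_range_succ' (fun i => ‖u i‖), Finset.mul_sum,
        ← add_assoc, ← Finset.sum_add_distrib, h0]
      gcongr with i _
      rw [h i]
      exact (norm_add_le _ _).trans (by rw [norm_mul])
    have h1 := key n
    have h2 : ∑ i ∈ Finset.range n, ‖t i‖ ≤ ∑ i ∈ Finset.range (n + 1), ‖t i‖ :=
      Finset.sum_le_sum_of_subset_of_nonneg (Finset.range_mono n.le_succ)
        fun _ _ _ => norm_nonneg _
    have h3 : ∑ i ∈ Finset.range (n + 1), ‖u i‖ ≤ ∑' n, ‖u n‖ :=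
      hu.norm.sum_le_tsum _ fun _ _ => norm_nonneg _
    linarith
  have e : ∑' n, t n = q * ∑' n, t n + ∑' n, u n := by
    conv_lhs => rw [hs.tsum_eq_zero_add]
    rw [hu.tsum_eq_zero_add, h0, ← tsum_mul_left]
    simp only [h]
    rw [((hs.mul_left q).tsum_add ((summable_nat_add_iff 1).2 hu))]
    ring
  have e' : ∑' n, t n = (1 - q)⁻¹ * ∑' n, u n := by
    field_simp
    linear_combination e
  exact e' ▸ hs.hasSum

variable {p}

theorem norm_levelRatio_lt_one (hp : p.Admissible) : ‖levelRatio p‖ < 1 := by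
  rw [levelRatio, Complex.norm_real, Real.norm_of_nonneg hp.boltzmann_nonneg]
  exact hp.boltzmann_lt_one

theorem one_sub_levelRatio_ne_zero (hp : p.Admissible) : 1 - levelRatio p ≠ 0 := by
  intro h'
  have hq := norm_levelRatio_lt_one hp
  rw [← sub_eq_zero.1 h'] at hq
  simp at hq

theorem hasSum_thermalTerm_one (hp : p.Admissible) : HasSum (thermalTerm p 1) 1 := by
  have h := (hasSum_geometric_of_norm_lt_one (norm_levelRatio_lt_one hp)).mul_left
    (1 - levelRatio p)
  rw [mul_inv_cancel₀ (one_sub_levelRatio_ne_zero hp)] at h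
  have e : thermalTerm p 1 = fun n => (1 - levelRatio p) * levelRatio p ^ n := by
    funext n
    simp [thermalTerm, numVec, levelRatio]
  rw [e]
  exact h

/-- `T X` is a series for the expectation of `X` in a thermal state of the boson mode with
annihilation operator `a` and creation operator `ad`. -/
structure IsThermal (p : Params) {B : Type*} [Ring B] [Algebra ℂ B] (a ad : B)
    (T : B → ℕ → ℂ) : Prop where
  add : ∀ X Y, T (X + Y) = T X + T Y
  smul : ∀ (c : ℂ) X, T (c • X) = fun n => c * T X n
  one : HasSum (T 1) 1
  mul_a_zero : ∀ X, T (X * a) 0 = 0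
  mul_a_succ : ∀ X n, T (X * a) (n + 1) = levelRatio p * T (a * X) n
  ad_mul_zero : ∀ X, T (ad * X) 0 = 0
  ad_mul_succ : ∀ X n, T (ad * X) (n + 1) = levelRatio p * T (X * ad) n

theorem isThermal_thermalTerm (hp : p.Admissible) : IsThermal p aB adB (thermalTerm p) where
  add := thermalTerm_add p
  smul := thermalTerm_smul p
  one := hasSum_thermalTerm_one hp
  mul_a_zero := thermalTerm_mul_aB_zero p
  mul_a_succ := thermalTerm_mul_aB_succ p
  ad_mul_zero := thermalTerm_adB_mul_zero p
  ad_mul_succ := thermalTerm_adB_mul_succ p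

namespace IsThermal

variable {B : Type*} [Ring B] [Algebra ℂ B] {a ad : B} {T : B → ℕ → ℂ}

theorem zero (hT : IsThermal p a ad T) : T 0 = 0 := by
  have h := hT.add 0 0
  rw [add_zero] at h
  exact left_eq_add.1 h

theorem lie_apply (hT : IsThermal p a ad T) (X Y : B) (n : ℕ) :
    T ⁅X, Y⁆ n = T (X * Y) n - T (Y * X) n := by
  have h : X * Y = ⁅X, Y⁆ + Y * X := by rw [Ring.lie_def, sub_add_cancel]
  rw [h, hT.add, Pi.add_apply, add_sub_cancel_right]

theorem hasSum_a_mul (hp : p.Admissible) (hT : IsThermal p a ad T) {X : B}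
    (h : Summable (T ⁅a, X⁆)) :
    HasSum (T (a * X)) ((1 - levelRatio p)⁻¹ * ∑' n, T ⁅a, X⁆ n) := by
  refine hasSum_of_linear_recurrence (norm_levelRatio_lt_one hp) ?_ (fun n => ?_) h
  · rw [hT.lie_apply, hT.mul_a_zero, sub_zero]
  · rw [hT.lie_apply, hT.mul_a_succ]
    ring

theorem hasSum_ad_mul (hp : p.Admissible) (hT : IsThermal p a ad T) {X : B}
    (h : Summable (T ⁅X, ad⁆)) :
    HasSum (T (ad * X)) ((1 - levelRatio p)⁻¹ * (levelRatio p * ∑' n, T ⁅X, ad⁆ n)) := by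
  have hs := (h.hasSum.mul_left (levelRatio p))
  -- Here the exchange comes before the commutator, so the inhomogeneity is delayed by one index and
  -- starts with 0.
  let u : ℕ → ℂ := fun n => Nat.casesOn n 0 fun n => levelRatio p * T ⁅X, ad⁆ n
  have hu : HasSum u (levelRatio p * ∑' n, T ⁅X, ad⁆ n) := by
    rw [← hasSum_nat_add_iff' 1]
    simpa [u] using hs
  rw [← hu.tsum_eq]
  refine hasSum_of_linear_recurrence (norm_levelRatio_lt_one hp) ?_ (fun n => ?_) hu.summable
  · rw [hT.ad_mul_zero]
    rfl
  · simp only [u]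
    rw [hT.lie_apply, hT.ad_mul_succ]
    ring

end IsThermal

end Boson

/-! ### Collective operators of the bath and their bosonic counterparts -/

section Emergence

/-- `(N + 1)^{-1/2}`. -/
noncomputable def invSqrt (N : ℕ) : ℂ := ((√((N : ℝ) + 1) : ℝ) : ℂ)⁻¹

/-- `ε^{-1/2}`. -/
noncomputable def Params.invSqrtε (p : Params) : ℂ := ((√p.ε : ℝ) : ℂ)⁻¹

theorem invSqrt_mul_self (N : ℕ) : invSqrt N * invSqrt N = ((N : ℂ) + 1)⁻¹ := by
  rw [invSqrt, ← mul_inv, ← Complex.ofReal_mul, Real.mul_self_sqrt (by positivity)]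
  push_cast
  rfl

theorem tendsto_invSqrt : Tendsto invSqrt atTop (𝓝 0) := by
  have h : Tendsto (fun N : ℕ => (√((N : ℝ) + 1))⁻¹) atTop (𝓝 0) := by
    refine tendsto_inv_atTop_zero.comp (Real.tendsto_sqrt_atTop.comp ?_)
    exact tendsto_atTop_add_const_right _ _ tendsto_natCast_atTop_atTop
  have h' := (Complex.continuous_ofReal.tendsto 0).comp h
  rw [Complex.ofReal_zero] at h'
  refine h'.congr fun N => ?_
  simp [invSqrt]

theorem Params.Admissible.invSqrtε_mul_self {p : Params} (hp : p.Admissible) :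
    p.invSqrtε * p.invSqrtε = (p.ε : ℂ)⁻¹ := by
  rw [Params.invSqrtε, ← mul_inv, ← Complex.ofReal_mul, Real.mul_self_sqrt hp.ε_pos.le]

theorem Params.Admissible.invSqrtε_ne_zero {p : Params} (hp : p.Admissible) :
    p.invSqrtε ≠ 0 := by
  rw [Params.invSqrtε]
  exact inv_ne_zero (Complex.ofReal_ne_zero.2 (Real.sqrt_ne_zero'.2 hp.ε_pos))

variable {p : Params}

theorem invSqrt_mul_eps (hp : p.Admissible) (N : ℕ) :
    ((√(p.ε * ((N + 1 : ℕ) : ℝ)) : ℝ) : ℂ)⁻¹ = p.invSqrtε * invSqrt N := by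
  rw [Real.sqrt_mul hp.ε_pos.le, Params.invSqrtε, invSqrt]
  push_cast
  rw [mul_inv]

theorem aN_eq (hp : p.Admissible) (N : ℕ) :
    aN p (N + 1) = (p.invSqrtε * invSqrt N) • siteSum (N + 1) lowering := by
  rw [aN, invSqrt_mul_eps hp, Sminus, siteSum]

theorem adN_eq (hp : p.Admissible) (N : ℕ) :
    adN p (N + 1) = (p.invSqrtε * invSqrt N) • siteSum (N + 1) raising := by
  rw [adN, invSqrt_mul_eps hp, Splus, siteSum]

theorem mz_eq (N : ℕ) : mz (N + 1) = (invSqrt N * invSqrt N) • siteSum (N + 1) (pauli 3) := by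
  rw [mz, invSqrt_mul_self, siteSum]
  push_cast
  rfl

theorem raising_eq : raising = !![0, 1; 0, 0] := by
  ext i j
  fin_cases i <;> fin_cases j <;> simp [raising, lowering, Matrix.conjTranspose_apply]

theorem pauli_three : pauli 3 = !![1, 0; 0, -1] := rfl

theorem lowering_commutator_raising : lowering * raising - raising * lowering = -pauli 3 := by
  rw [raising_eq, lowering, pauli_three]
  ext i j
  fin_cases i <;> fin_cases j <;> simp

theorem pauli_commutator_lowering :
    pauli 3 * lowering - lowering * pauli 3 = (-2 : ℂ) • lowering := by
  rw [lowering, pauli_three]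
  ext i j
  fin_cases i <;> fin_cases j <;> simp
  norm_num

theorem pauli_commutator_raising :
    pauli 3 * raising - raising * pauli 3 = (2 : ℂ) • raising := by
  rw [raising_eq, pauli_three]
  ext i j
  fin_cases i <;> fin_cases j <;> simp
  norm_num

/-! ### Commutation relations of the rescaled collective operators -/

theorem lie_aN_adN (hp : p.Admissible) (N : ℕ) :
    ⁅aN p (N + 1), adN p (N + 1)⁆ = (-(p.ε : ℂ)⁻¹) • mz (N + 1) := by
  have h := lie_siteSum (N := N + 1) lowering raising
  rw [lowering_commutator_raising, ← neg_one_smul ℂ (pauli 3), siteSum_smul] at h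
  rw [aN_eq hp, adN_eq hp, mz_eq, ← hp.invSqrtε_mul_self, smul_lie_ring, lie_smul_ring, h]
  module

theorem lie_mz_aN (hp : p.Admissible) (N : ℕ) :
    ⁅mz (N + 1), aN p (N + 1)⁆ = (-2 : ℂ) • invSqrt N • invSqrt N • aN p (N + 1) := by
  have h := lie_siteSum (N := N + 1) (pauli 3) lowering
  rw [pauli_commutator_lowering, siteSum_smul] at h
  rw [aN_eq hp, mz_eq, smul_lie_ring, lie_smul_ring, h]
  module

theorem lie_mz_adN (hp : p.Admissible) (N : ℕ) :
    ⁅mz (N + 1), adN p (N + 1)⁆ = (2 : ℂ) • invSqrt N • invSqrt N • adN p (N + 1) := by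
  have h := lie_siteSum (N := N + 1) (pauli 3) raising
  rw [pauli_commutator_raising, siteSum_smul] at h
  rw [adN_eq hp, mz_eq, smul_lie_ring, lie_smul_ring, h]
  module

variable {B : Type*} [Ring B] [Algebra ℂ B] {a ad : B}

/-- `Emerges p a ad n x b`: the sequence `x` of bath operators is a polynomial of degree at most `n` in
`a_N`, `a_N†` and `m_z^N`, with coefficients polynomial in the number of bath spins to the power
`-1/2`, and `b` is the element of `B` obtained by replacing these by `a`, `a†`, `-ε` and `0`. -/
inductive Emerges (p : Params) (a ad : B) : ℕ → (∀ N : ℕ, BathMat (N + 1)) → B → Prop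
  | one (n : ℕ) : Emerges p a ad n (fun _ => 1) 1
  | add {n x y b c} : Emerges p a ad n x b → Emerges p a ad n y c →
      Emerges p a ad n (fun N => x N + y N) (b + c)
  | smul {n x b} (c : ℂ) : Emerges p a ad n x b → Emerges p a ad n (fun N => c • x N) (c • b)
  | scale {n x b} : Emerges p a ad n x b → Emerges p a ad n (fun N => invSqrt N • x N) 0
  | lower {n x b} : Emerges p a ad n x b → Emerges p a ad (n + 1) (fun N => aN p (N + 1) * x N) (a * b)
  | raise {n x b} : Emerges p a ad n x b → Emerges p a ad (n + 1) (fun N => adN p (N + 1) * x N) (ad * b)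
  | mag {n x b} : Emerges p a ad n x b →
      Emerges p a ad (n + 1) (fun N => mz (N + 1) * x N) (-(p.ε : ℂ) • b)

namespace Emerges

variable {n k : ℕ} {x y : ∀ N : ℕ, BathMat (N + 1)} {b c : B}

theorem congr (h : Emerges p a ad n x b) (hx : ∀ N, y N = x N) (hb : c = b) : Emerges p a ad n y c := by
  rw [hb, funext hx]; exact h

theorem zero (n : ℕ) : Emerges p a ad n (fun _ => 0) 0 :=
  ((one n).smul 0).congr (fun _ => (zero_smul _ _).symm) (zero_smul _ _).symm

theorem sub (hx : Emerges p a ad n x b) (hy : Emerges p a ad n y c) :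
    Emerges p a ad n (fun N => x N - y N) (b - c) :=
  (hx.add (hy.smul (-1))).congr (fun _ => by module) (by module)

theorem succ (h : Emerges p a ad n x b) : Emerges p a ad (n + 1) x b := by
  induction h with
  | one n => exact one _
  | add _ _ h1 h2 => exact h1.add h2
  | smul c _ h => exact h.smul c
  | scale _ h => exact h.scale
  | lower _ h => exact h.lower
  | raise _ h => exact h.raise
  | mag _ h => exact h.mag

theorem add_left (h : Emerges p a ad n x b) (k : ℕ) : Emerges p a ad (k + n) x b := by
  induction k with
  | zero => rwa [zero_add]
  | succ k ih => rw [Nat.add_right_comm]; exact ih.succ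

theorem mul (hx : Emerges p a ad n x b) (hy : Emerges p a ad k y c) :
    Emerges p a ad (n + k) (fun N => x N * y N) (b * c) := by
  induction hx with
  | one n => exact (hy.add_left n).congr (fun _ => one_mul _) (one_mul _)
  | add _ _ h1 h2 => exact (h1.add h2).congr (fun _ => add_mul _ _ _) (add_mul _ _ _)
  | smul c _ h => exact (h.smul c).congr (fun _ => smul_mul_assoc _ _ _) (smul_mul_assoc _ _ _)
  | scale _ h => exact h.scale.congr (fun _ => smul_mul_assoc _ _ _) (zero_mul _)
  | lower _ h =>
    rw [Nat.add_right_comm]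
    exact h.lower.congr (fun _ => mul_assoc _ _ _) (mul_assoc _ _ _)
  | raise _ h =>
    rw [Nat.add_right_comm]
    exact h.raise.congr (fun _ => mul_assoc _ _ _) (mul_assoc _ _ _)
  | mag _ h =>
    rw [Nat.add_right_comm]
    exact h.mag.congr (fun _ => mul_assoc _ _ _) (smul_mul_assoc _ _ _)

/-- The degree bound does not grow: commuting replaces a letter by at most one letter, a_N by -m_z/ε
and m_z by (2/N) a_N†. -/
theorem lie_adN (hp : p.Admissible) (hab : ⁅a, ad⁆ = 1) (h : Emerges p a ad n x b) :
    Emerges p a ad n (fun N => ⁅x N, adN p (N + 1)⁆) ⁅b, ad⁆ := by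
  induction h with
  | one n => exact (zero n).congr (fun _ => one_lie_ring _) (one_lie_ring _)
  | add _ _ h1 h2 => exact (h1.add h2).congr (fun _ => add_lie_ring _ _ _) (add_lie_ring _ _ _)
  | smul c _ h => exact (h.smul c).congr (fun _ => smul_lie_ring _ _ _) (smul_lie_ring _ _ _)
  | scale _ h => exact h.scale.congr (fun _ => smul_lie_ring _ _ _) (zero_lie_ring _)
  | @lower n x b hx h =>
    have hε : (p.ε : ℂ) ≠ 0 := Complex.ofReal_ne_zero.2 hp.ε_pos.ne'
    -- The formal limit of -m_z/ε is (-1/ε)(-ε) = 1, in agreement with [a, a†] = 1.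
    refine (h.lower.add (hx.mag.smul (-(p.ε : ℂ)⁻¹))).congr (fun N => ?_) ?_
    · rw [← smul_mul_assoc, ← lie_aN_adN hp, mul_lie_ring]
    · rw [mul_lie_ring, hab, one_mul, smul_smul, neg_mul_neg, inv_mul_cancel₀ hε, one_smul]
  | @raise n x b hx h =>
    exact h.raise.congr (fun N => by rw [mul_lie_ring, lie_self_ring, zero_mul, add_zero])
      (by rw [mul_lie_ring, lie_self_ring, zero_mul, add_zero])
  | @mag n x b hx h =>
    refine (h.mag.add (hx.raise.scale.scale.smul 2)).congr (fun N => ?_) ?_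
    · rw [← smul_mul_assoc, ← smul_mul_assoc, ← smul_mul_assoc, ← lie_mz_adN hp, mul_lie_ring]
    · rw [smul_lie_ring, smul_zero, add_zero]

theorem aN_lie (hp : p.Admissible) (hab : ⁅a, ad⁆ = 1) (h : Emerges p a ad n x b) :
    Emerges p a ad n (fun N => ⁅aN p (N + 1), x N⁆) ⁅a, b⁆ := by
  induction h with
  | one n => exact (zero n).congr (fun _ => lie_one_ring _) (lie_one_ring _)
  | add _ _ h1 h2 => exact (h1.add h2).congr (fun _ => lie_add_ring _ _ _) (lie_add_ring _ _ _)
  | smul c _ h => exact (h.smul c).congr (fun _ => lie_smul_ring _ _ _) (lie_smul_ring _ _ _)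
  | scale _ h => exact h.scale.congr (fun _ => lie_smul_ring _ _ _) (lie_zero_ring _)
  | @lower n x b hx h =>
    exact h.lower.congr (fun N => by rw [lie_mul_ring, lie_self_ring, zero_mul, add_zero])
      (by rw [lie_mul_ring, lie_self_ring, zero_mul, add_zero])
  | @raise n x b hx h =>
    have hε : (p.ε : ℂ) ≠ 0 := Complex.ofReal_ne_zero.2 hp.ε_pos.ne'
    refine (h.raise.add (hx.mag.smul (-(p.ε : ℂ)⁻¹))).congr (fun N => ?_) ?_
    · rw [← smul_mul_assoc, ← lie_aN_adN hp, lie_mul_ring]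
    · rw [lie_mul_ring, hab, one_mul, smul_smul, neg_mul_neg, inv_mul_cancel₀ hε, one_smul]
  | @mag n x b hx h =>
    refine (h.mag.add (hx.lower.scale.scale.smul 2)).congr (fun N => ?_) ?_
    · rw [← smul_mul_assoc, ← smul_mul_assoc, ← smul_mul_assoc, lie_mul_ring, lie_skew_ring (aN p (N + 1)) (mz (N + 1)),
        lie_mz_aN hp, ← neg_smul, neg_neg]
    · rw [lie_smul_ring, smul_zero, add_zero]

end Emerges

/-- The expectation of a one-site operator in the stationary state, for the given `ε`. -/
noncomputable def siteMean (p : Params) (A : SpinMat) : ℂ :=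
  (A 0 0 + A 1 1) / 2 - p.ε * ((A 0 0 - A 1 1) / 2)

theorem spinMat_eq (A : SpinMat) :
    A = ((A 0 0 + A 1 1) / 2) • 1 + ((A 0 0 - A 1 1) / 2) • pauli 3 + A 0 1 • raising
      + A 1 0 • lowering := by
  rw [raising_eq, pauli_three, lowering]
  ext i j
  fin_cases i <;> fin_cases j <;> simp <;> ring

/-- A law of large numbers: in the basis 1, σ_z, σ_±, the averages of σ_± are multiples of a_N† and
a_N divided by √N and disappear, while the average of σ_z becomes -ε. -/
theorem Emerges.average (hp : p.Admissible) (A : SpinMat) {n : ℕ} {x : ∀ N : ℕ, BathMat (N + 1)}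
    {b : B} (h : Emerges p a ad n x b) :
    Emerges p a ad (n + 1) (fun N => (invSqrt N * invSqrt N) • (siteSum (N + 1) A * x N))
      (siteMean p A • b) := by
  refine ((((h.succ.smul ((A 0 0 + A 1 1) / 2)).add (h.mag.smul ((A 0 0 - A 1 1) / 2))).add
    (h.raise.scale.smul (A 0 1 * p.invSqrtε⁻¹))).add
    (h.lower.scale.smul (A 1 0 * p.invSqrtε⁻¹))).congr (fun N => ?_) ?_
  · have he := hp.invSqrtε_ne_zero
    have hN : invSqrt N * invSqrt N * ((N : ℂ) + 1) = 1 := by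
      rw [invSqrt_mul_self]; exact inv_mul_cancel₀ (by exact_mod_cast N.succ_ne_zero)
    conv_lhs => rw [spinMat_eq A]
    simp only [siteSum_add, siteSum_smul, siteSum_one, adN_eq hp, aN_eq hp, mz_eq, add_mul,
      smul_add, smul_mul_assoc, one_mul, smul_smul]
    push_cast
    congr 1
    · congr 1
      · congr 1
        · congr 1
          linear_combination ((A 0 0 + A 1 1) / 2) * hN
        · congr 1; ring
      · congr 1; field_simp
    · congr 1; field_simp
  · rw [siteMean]; module

/-- The limit of `∑ₖ s^{(k)} [X, t^{(k)}] / √N`. -/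
noncomputable def siteCommLimit (p : Params) (a ad : B) (s t : SpinMat) (b : B) : B :=
  (p.invSqrtε * siteMean p (s * (lowering * t - t * lowering))) • ⁅b, ad⁆
    + (p.invSqrtε * siteMean p (s * (raising * t - t * raising))) • ⁅a, b⁆

/-- The maps [·, a†] and [a, ·] act as derivatives in a and a†, so the limit obeys a Leibniz rule.
-/
theorem siteCommLimit_a_mul (hab : ⁅a, ad⁆ = 1) (s t : SpinMat) (b : B) :
    siteCommLimit p a ad s t (a * b) =
      (p.invSqrtε * siteMean p (s * (lowering * t - t * lowering))) • b
        + a * siteCommLimit p a ad s t b := by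
  rw [siteCommLimit, siteCommLimit, mul_lie_ring, lie_mul_ring, lie_self_ring, zero_mul, add_zero,
    hab, one_mul, mul_add, mul_smul_comm, mul_smul_comm]
  module

theorem siteCommLimit_ad_mul (hab : ⁅a, ad⁆ = 1) (s t : SpinMat) (b : B) :
    siteCommLimit p a ad s t (ad * b) =
      (p.invSqrtε * siteMean p (s * (raising * t - t * raising))) • b
        + ad * siteCommLimit p a ad s t b := by
  rw [siteCommLimit, siteCommLimit, mul_lie_ring, lie_mul_ring, lie_self_ring, zero_mul, add_zero,
    hab, one_mul, mul_add, mul_smul_comm, mul_smul_comm]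
  module

theorem siteCommLimit_smul (s t : SpinMat) (c : ℂ) (b : B) :
    siteCommLimit p a ad s t (c • b) = c • siteCommLimit p a ad s t b := by
  rw [siteCommLimit, siteCommLimit, smul_lie_ring, lie_smul_ring]
  module

theorem siteCommLimit_add (s t : SpinMat) (b c : B) :
    siteCommLimit p a ad s t (b + c) = siteCommLimit p a ad s t b + siteCommLimit p a ad s t c := by
  rw [siteCommLimit, siteCommLimit, siteCommLimit, add_lie_ring, lie_add_ring]
  module

theorem siteCommLimit_zero (s t : SpinMat) : siteCommLimit p a ad s t 0 = 0 := by
  rw [siteCommLimit, zero_lie_ring, lie_zero_ring, smul_zero, smul_zero, add_zero]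

theorem siteCommLimit_one (s t : SpinMat) : siteCommLimit p a ad s t 1 = 0 := by
  rw [siteCommLimit, one_lie_ring, lie_one_ring, smul_zero, smul_zero, add_zero]

theorem Emerges.siteComm (hp : p.Admissible) (hab : ⁅a, ad⁆ = 1) {n : ℕ} {x : ∀ N : ℕ, BathMat (N + 1)}
    {b : B} (h : Emerges p a ad n x b) (s t : SpinMat) :
    Emerges p a ad n (fun N => invSqrt N • CentralSpin.siteComm s t (x N))
      (siteCommLimit p a ad s t b) := by
  -- Moving `s` past a collective operator replaces it by a commutator, so the induction needs every
  -- `s`.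
  induction h generalizing s with
  | one n =>
    exact (zero n).congr (fun _ => by rw [siteComm_one, smul_zero]) (siteCommLimit_one _ _)
  | add _ _ h1 h2 =>
    exact ((h1 s).add (h2 s)).congr (fun _ => by rw [siteComm_add, smul_add])
      (siteCommLimit_add _ _ _ _)
  | smul c _ h =>
    exact ((h s).smul c).congr (fun _ => by rw [siteComm_smul, smul_comm])
      (siteCommLimit_smul _ _ _ _)
  | scale _ h =>
    exact (h s).scale.congr (fun _ => by rw [siteComm_smul]) (siteCommLimit_zero _ _)
  | @lower n x b hx h =>
    -- The factor N^{-1/2} in a_N combines with the prefactor into an average over the sites; the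
    -- reordering term keeps a spare N^{-1/2} and vanishes.
    refine (((hx.average hp (s * (lowering * t - t * lowering))).smul p.invSqrtε).add
      ((h s).lower.add ((h (s * lowering - lowering * s)).scale.smul p.invSqrtε).succ)).congr
      (fun N => ?_) ?_
    · beta_reduce
      rw [aN_eq hp, smul_mul_assoc, siteComm_smul, siteComm_siteSum_mul, smul_mul_assoc,
        mul_smul_comm]
      module
    · rw [siteCommLimit_a_mul hab, smul_zero, add_zero, smul_smul]
  | @raise n x b hx h =>
    refine (((hx.average hp (s * (raising * t - t * raising))).smul p.invSqrtε).add
      ((h s).raise.add ((h (s * raising - raising * s)).scale.smul p.invSqrtε).succ)).congr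
      (fun N => ?_) ?_
    · beta_reduce
      rw [adN_eq hp, smul_mul_assoc, siteComm_smul, siteComm_siteSum_mul, smul_mul_assoc,
        mul_smul_comm]
      module
    · rw [siteCommLimit_ad_mul hab, smul_zero, add_zero, smul_smul]
  | @mag n x b hx h =>
    -- The 1/N in m_z leaves a spare power of N^{-1/2} on both extra terms, so neither contributes.
    refine ((hx.average hp (s * (pauli 3 * t - t * pauli 3))).scale.add
      ((h s).mag.add (h (s * pauli 3 - pauli 3 * s)).scale.scale.succ)).congr
      (fun N => ?_) ?_
    · beta_reduce
      rw [mz_eq, smul_mul_assoc, siteComm_smul, siteComm_siteSum_mul, smul_mul_assoc,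
        mul_smul_comm]
      module
    · rw [siteCommLimit_smul, zero_add, add_zero]

/-! ### Convergence of the expectations -/

theorem Emerges.tendsto (hp : p.Admissible) (hab : ⁅a, ad⁆ = 1) {T : B → ℕ → ℂ}
    (hT : IsThermal p a ad T) {n : ℕ} {x : ∀ N : ℕ, BathMat (N + 1)}
    {b : B} (h : Emerges p a ad n x b) :
    Summable (T b) ∧
      Tendsto (fun N => OmegaSS p (N + 1) (x N)) atTop (𝓝 (∑' k, T b k)) := by
  -- The outer induction is on the degree, the inner one on the derivation. Sums, multiples and
  -- rescalings keep the degree and use the inner hypothesis; stripping a letter lowers it and uses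
  -- the outer one.
  induction n using Nat.strong_induction_on generalizing x b with
  | _ n IH =>
  induction h with
  | one n =>
    refine ⟨hT.one.summable, ?_⟩
    rw [hT.one.tsum_eq]
    simp only [OmegaSS_one hp]
    exact tendsto_const_nhds
  | add _ _ h1 h2 =>
    obtain ⟨s1, t1⟩ := h1 IH
    obtain ⟨s2, t2⟩ := h2 IH
    refine ⟨by rw [hT.add]; exact s1.add s2, ?_⟩
    have e := s1.tsum_add s2
    simp only [OmegaSS_add]
    rw [hT.add]
    simp only [Pi.add_apply]
    rw [e]
    exact t1.add t2
  | smul c _ h =>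
    obtain ⟨s1, t1⟩ := h IH
    refine ⟨by rw [hT.smul]; exact s1.mul_left c, ?_⟩
    simp only [OmegaSS_smul]
    rw [hT.smul]
    rw [tsum_mul_left]
    exact t1.const_mul c
  | scale _ h =>
    obtain ⟨s1, t1⟩ := h IH
    refine ⟨by rw [hT.zero]; exact summable_zero, ?_⟩
    have e := tendsto_invSqrt.mul t1
    rw [zero_mul] at e
    simpa only [OmegaSS_smul, hT.zero, Pi.zero_apply, tsum_zero] using e
  | @lower n x b hx _ =>
    -- The commutator of a_N with `x` still has degree at most `n`, one less than a_N x. Both sides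
    -- are then divided by 1 - q.
    obtain ⟨s1, t1⟩ := IH n n.lt_succ_self (hx.aN_lie hp hab)
    have e := hT.hasSum_a_mul hp s1
    refine ⟨e.summable, ?_⟩
    rw [e.tsum_eq]
    refine (t1.const_mul _).congr fun N => ?_
    have hq := one_sub_levelRatio_ne_zero hp
    rw [Ring.lie_def, OmegaSS_sub, OmegaSS_mul_aN hp]
    field_simp
  | @raise n x b hx _ =>
    obtain ⟨s1, t1⟩ := IH n n.lt_succ_self (hx.lie_adN hp hab)
    have e := hT.hasSum_ad_mul hp s1
    refine ⟨e.summable, ?_⟩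
    rw [e.tsum_eq]
    refine ((t1.const_mul _).const_mul _).congr fun N => ?_
    have hq := one_sub_levelRatio_ne_zero hp
    rw [Ring.lie_def, OmegaSS_sub, mul_sub, ← OmegaSS_adN_mul hp]
    field_simp
  | @mag n x b hx _ =>
    obtain ⟨s1, t1⟩ := IH n n.lt_succ_self hx
    obtain ⟨_, t2⟩ := IH n n.lt_succ_self (hx.siteComm hp hab lowering raising)
    refine ⟨by rw [hT.smul]; exact s1.mul_left _, ?_⟩
    rw [hT.smul]
    rw [tsum_mul_left]
    -- The 1/N of the correction is split into two factors N^{-1/2}: one makes the commutator sum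
    -- converge, the other sends it to 0.
    have e := (t1.const_mul (-(p.ε : ℂ))).add
      ((tendsto_invSqrt.mul t2).const_mul (2 * levelRatio p / (1 + levelRatio p)))
    rw [zero_mul, mul_zero, add_zero] at e
    refine e.congr fun N => ?_
    rw [OmegaSS_mz_mul hp N.succ_ne_zero, OmegaSS_smul, ← mul_assoc (invSqrt N),
      invSqrt_mul_self]
    push_cast
    rfl

end Emergence

/-! ### The dissipators under emergence -/

section Dissipation

variable {p : Params} {B : Type*} [Ring B] [Algebra ℂ B] {a ad : B}

/-- The dissipator of the boson mode with annihilation operator `a` and creation operator `ad`. -/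
noncomputable def bosonDiss (p : Params) (a ad X : B) : B :=
  (κdown p : ℂ) • dissipator a ad X + (κup p : ℂ) • dissipator ad a X

theorem bosonDiss_add (X Y : B) :
    bosonDiss p a ad (X + Y) = bosonDiss p a ad X + bosonDiss p a ad Y := by
  simp only [bosonDiss, dissipator_add, smul_add]
  abel

theorem bosonDiss_smul (c : ℂ) (X : B) : bosonDiss p a ad (c • X) = c • bosonDiss p a ad X := by
  simp only [bosonDiss, dissipator_smul, smul_add, smul_comm c]

theorem bosonDiss_one : bosonDiss p a ad 1 = 0 := by
  simp [bosonDiss, dissipator_one]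

theorem bosonDiss_zero : bosonDiss p a ad 0 = 0 := by
  simpa using bosonDiss_smul (p := p) (a := a) (ad := ad) 0 0

theorem κdown_eq (hp : p.Admissible) : (κdown p : ℂ) = p.Γdown * (p.ε : ℂ)⁻¹ := by
  have h := hp.ε_pos.ne'
  have h' := hp.plus_mul_ε
  have : κdown p = p.Γdown * p.ε⁻¹ := by
    rw [κdown]; field_simp; linarith
  rw [this]; push_cast; rfl

theorem κup_eq : (κup p : ℂ) = p.Γup * (p.ε : ℂ)⁻¹ := by
  rw [κup, div_eq_mul_inv]; push_cast; rfl

theorem κdown_sub_κup : (κdown p : ℂ) - κup p = p.Γplus := by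
  rw [κdown, κup]; push_cast; ring

theorem dissipator_self {R : Type*} [Ring R] [Algebra ℂ R] (ν νd : R) :
    dissipator ν νd ν = (-(1 / 2 : ℂ)) • (⁅ν, νd⁆ * ν) := by
  simp only [dissipator, Ring.lie_def, sub_mul, smul_sub, smul_add, mul_assoc]
  module

theorem dissipator_adjoint {R : Type*} [Ring R] [Algebra ℂ R] (ν νd : R) :
    dissipator ν νd νd = (-(1 / 2 : ℂ)) • (νd * ⁅ν, νd⁆) := by
  simp only [dissipator, Ring.lie_def, mul_sub, smul_sub, smul_add, mul_assoc]
  module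

/-- The damping -Γ_+/2 comes from κ_↓ - κ_↑ = Γ_+; only the loss channel has a nonzero cross term.
-/
theorem bosonDiss_a_mul (hab : ⁅a, ad⁆ = 1) (b : B) :
    bosonDiss p a ad (a * b) = (-(p.Γplus : ℂ) / 2) • (a * b) + a * bosonDiss p a ad b
      + (κdown p : ℂ) • ⁅a, b⁆ := by
  rw [bosonDiss, dissipator_mul, dissipator_mul, dissipator_self, dissipator_adjoint, lie_self_ring,
    lie_skew_ring b a, lie_skew_ring ad a, hab, bosonDiss, ← κdown_sub_κup]
  simp only [one_mul, mul_one, zero_mul, mul_add, mul_smul_comm, smul_mul_assoc, mul_neg,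
    neg_mul]
  module

theorem bosonDiss_ad_mul (hab : ⁅a, ad⁆ = 1) (b : B) :
    bosonDiss p a ad (ad * b) = (-(p.Γplus : ℂ) / 2) • (ad * b) + ad * bosonDiss p a ad b
      + (κup p : ℂ) • ⁅b, ad⁆ := by
  rw [bosonDiss, dissipator_mul, dissipator_mul, dissipator_self, dissipator_adjoint, lie_self_ring,
    lie_skew_ring ad a, hab, bosonDiss, ← κdown_sub_κup]
  simp only [one_mul, mul_one, zero_mul, mul_add, mul_smul_comm, smul_mul_assoc, neg_mul]
  module

/-! ### Matching the one-spin dissipation with the bosonic rates -/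

theorem dissipation_lowering :
    (p.Γdown : ℂ) • dissipator lowering raising lowering
      + (p.Γup : ℂ) • dissipator raising lowering lowering = (-(p.Γplus : ℂ) / 2) • lowering := by
  rw [Params.Γplus, raising_eq, lowering]
  ext i j
  fin_cases i <;> fin_cases j <;> simp [dissipator]
  ring

theorem dissipation_raising :
    (p.Γdown : ℂ) • dissipator lowering raising raising
      + (p.Γup : ℂ) • dissipator raising lowering raising = (-(p.Γplus : ℂ) / 2) • raising := by
  rw [Params.Γplus, raising_eq, lowering]
  ext i j
  fin_cases i <;> fin_cases j <;> simp [dissipator]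
  ring

/-- Stationarity of the bath state, tested on σ_z; it amounts to Γ_+ ε = Γ_↓ - Γ_↑. -/
theorem siteMean_dissipation_pauli (hp : p.Admissible) :
    siteMean p ((p.Γdown : ℂ) • dissipator lowering raising (pauli 3)
      + (p.Γup : ℂ) • dissipator raising lowering (pauli 3)) = 0 := by
  have h : (p.Γplus : ℂ) * p.ε = p.Γdown - p.Γup := by exact_mod_cast hp.plus_mul_ε
  rw [Params.Γplus] at h
  push_cast at h
  rw [siteMean, raising_eq, pauli_three, lowering]
  simp [dissipator]
  linear_combination h

theorem raising_commutator_lowering : raising * lowering - lowering * raising = pauli 3 := by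
  rw [← neg_sub, lowering_commutator_raising, neg_neg]

theorem siteMean_pauli_sq : siteMean p (pauli 3 * pauli 3) = 1 := by
  simp [siteMean, pauli_three, Matrix.mul_apply]

theorem siteMean_zero : siteMean p 0 = 0 := by
  simp [siteMean]

/-- Since σ_z [σ_+, σ_-] = σ_z² = 1, no mean value of σ_z enters, and two factors ε^{-1/2} turn Γ_↓
into κ_↓ = Γ_↓/ε. -/
theorem siteCommLimit_pauli_lowering (hp : p.Admissible) (b : B) :
    (p.invSqrtε * p.Γdown) • siteCommLimit p a ad (pauli 3) lowering b
      = (κdown p : ℂ) • ⁅a, b⁆ := by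
  rw [siteCommLimit, sub_self, mul_zero, siteMean_zero, raising_commutator_lowering,
    siteMean_pauli_sq, κdown_eq hp, ← hp.invSqrtε_mul_self]
  module

theorem siteCommLimit_pauli_raising (hp : p.Admissible) (b : B) :
    (p.invSqrtε * p.Γup) • siteCommLimit p a ad (-pauli 3) raising b
      = (κup p : ℂ) • ⁅b, ad⁆ := by
  rw [siteCommLimit, sub_self, mul_zero, siteMean_zero, lowering_commutator_raising,
    neg_mul_neg, siteMean_pauli_sq, κup_eq, ← hp.invSqrtε_mul_self]
  module

theorem siteComm_zero {N : ℕ} (t : SpinMat) (X : BathMat N) : siteComm 0 t X = 0 := by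
  simp [siteComm, site_zero]

/-- Peeling off one letter at a time gives the same Leibniz recursion for both dissipators. For m_z
the drift averages to zero and the cross terms carry a spare N^{-1/2}, so in the limit it behaves as
the scalar -ε. -/
theorem Emerges.bathDiss (hp : p.Admissible) (hab : ⁅a, ad⁆ = 1) {n : ℕ} {x : ∀ N : ℕ, BathMat (N + 1)}
    {b : B} (h : Emerges p a ad n x b) :
    Emerges p a ad n (fun N => CentralSpin.bathDiss p (x N)) (bosonDiss p a ad b) := by
  induction h with
  | one n => exact (zero n).congr (fun _ => bathDiss_one p) bosonDiss_one
  | add _ _ h1 h2 => exact (h1.add h2).congr (fun _ => bathDiss_add _ _ _) (bosonDiss_add _ _)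
  | smul c _ h => exact (h.smul c).congr (fun _ => bathDiss_smul _ _ _) (bosonDiss_smul _ _)
  | scale _ h => exact h.scale.congr (fun _ => bathDiss_smul _ _ _) bosonDiss_zero
  | @lower n x b hx h =>
    refine (((hx.lower.smul (-(p.Γplus : ℂ) / 2)).add h.lower).add
      ((hx.siteComm hp hab (pauli 3) lowering).smul (p.invSqrtε * p.Γdown)).succ).congr
      (fun N => ?_) ?_
    · beta_reduce
      rw [aN_eq hp, smul_mul_assoc, bathDiss_smul, bathDiss_siteSum_mul, dissipation_lowering,
        raising_commutator_lowering, sub_self, siteComm_zero, siteSum_smul, smul_mul_assoc,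
        smul_mul_assoc]
      module
    · rw [siteCommLimit_pauli_lowering hp, bosonDiss_a_mul hab]
  | @raise n x b hx h =>
    refine (((hx.raise.smul (-(p.Γplus : ℂ) / 2)).add h.raise).add
      ((hx.siteComm hp hab (-pauli 3) raising).smul (p.invSqrtε * p.Γup)).succ).congr
      (fun N => ?_) ?_
    · beta_reduce
      rw [adN_eq hp, smul_mul_assoc, bathDiss_smul, bathDiss_siteSum_mul, dissipation_raising,
        lowering_commutator_raising, sub_self, siteComm_zero, siteSum_smul, smul_mul_assoc,
        smul_mul_assoc]
      module
    · rw [siteCommLimit_pauli_raising hp, bosonDiss_ad_mul hab]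
  | @mag n x b hx h =>
    refine (((hx.average hp ((p.Γdown : ℂ) • dissipator lowering raising (pauli 3)
      + (p.Γup : ℂ) • dissipator raising lowering (pauli 3))).add h.mag).add
      (((hx.siteComm hp hab (raising * pauli 3 - pauli 3 * raising) lowering).scale.smul
        (p.Γdown : ℂ)).add
      ((hx.siteComm hp hab (lowering * pauli 3 - pauli 3 * lowering) raising).scale.smul
        (p.Γup : ℂ))).succ).congr (fun N => ?_) ?_
    · beta_reduce
      rw [mz_eq, smul_mul_assoc, bathDiss_smul, bathDiss_siteSum_mul, smul_mul_assoc]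
      module
    · rw [siteMean_dissipation_pauli hp, bosonDiss_smul]
      simp

end Dissipation

/-! ### The composite system -/

section Composite

variable {p : Params} {B : Type*} [Ring B] [Algebra ℂ B] {a ad : B}

/-- All matrix entries of the composite operators emerge in the limit. -/
def MatEmerges (p : Params) (a ad : B) (X : ∀ N : ℕ, Matrix (Fin 2) (Fin 2) (BathMat (N + 1)))
    (Y : Matrix (Fin 2) (Fin 2) B) : Prop :=
  ∀ i j, ∃ n, Emerges p a ad n (fun N => X N i j) (Y i j)

/-- The Jaynes-Cummings interaction with annihilation operator `a` and creation operator `ad`. -/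
noncomputable def jaynesCummings (p : Params) (a ad : B) : Matrix (Fin 2) (Fin 2) B :=
  ((p.g₀ * √p.ε : ℝ) : ℂ) • (spinOp lowering * envOp ad + spinOp raising * envOp a)

/-- The emergent generator with annihilation operator `a` and creation operator `ad`. -/
noncomputable def emergentGenerator (p : Params) (a ad : B) (Y : Matrix (Fin 2) (Fin 2) B) :
    Matrix (Fin 2) (Fin 2) B :=
  hamPart (hamTau p.w + jaynesCummings p a ad) Y + dissTau p.γdown p.γup Y
    + ((κdown p : ℂ) • dissipator (envOp a) (envOp ad) Y
      + (κup p : ℂ) • dissipator (envOp ad) (envOp a) Y)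

theorem Emerges.exists_add {n k : ℕ} {x y : ∀ N : ℕ, BathMat (N + 1)} {b c : B}
    (hx : Emerges p a ad n x b) (hy : Emerges p a ad k y c) :
    ∃ m, Emerges p a ad m (fun N => x N + y N) (b + c) :=
  ⟨n + k, (Nat.add_comm k n ▸ hx.add_left k).add (hy.add_left n)⟩

namespace MatEmerges

variable {X X' : ∀ N : ℕ, Matrix (Fin 2) (Fin 2) (BathMat (N + 1))}
  {Y Y' : Matrix (Fin 2) (Fin 2) B}

theorem congr (h : MatEmerges p a ad X Y) (hX : ∀ N, X' N = X N) (hY : Y' = Y) :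
    MatEmerges p a ad X' Y' := by
  rw [hY, funext hX]; exact h

theorem add (h : MatEmerges p a ad X Y) (h' : MatEmerges p a ad X' Y') :
    MatEmerges p a ad (fun N => X N + X' N) (Y + Y') := by
  intro i j
  obtain ⟨n, hn⟩ := h i j
  obtain ⟨k, hk⟩ := h' i j
  exact hn.exists_add hk

theorem smul (c : ℂ) (h : MatEmerges p a ad X Y) :
    MatEmerges p a ad (fun N => c • X N) (c • Y) := by
  intro i j
  obtain ⟨n, hn⟩ := h i j
  exact ⟨n, hn.smul c⟩

theorem sub (h : MatEmerges p a ad X Y) (h' : MatEmerges p a ad X' Y') :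
    MatEmerges p a ad (fun N => X N - X' N) (Y - Y') :=
  (h.add (h'.smul (-1))).congr (fun _ => by module) (by module)

theorem mul (h : MatEmerges p a ad X Y) (h' : MatEmerges p a ad X' Y') :
    MatEmerges p a ad (fun N => X N * X' N) (Y * Y') := by
  intro i j
  obtain ⟨n0, h0⟩ := h i 0
  obtain ⟨k0, h0'⟩ := h' 0 j
  obtain ⟨n1, h1⟩ := h i 1
  obtain ⟨k1, h1'⟩ := h' 1 j
  simp only [Matrix.mul_apply, Fin.sum_univ_two]
  exact (h0.mul h0').exists_add (h1.mul h1')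

theorem spinOp (A : SpinMat) :
    MatEmerges p a ad (fun _ => CentralSpin.spinOp A) (CentralSpin.spinOp A) := by
  intro i j
  refine ⟨0, ((Emerges.one 0).smul (A i j)).congr (fun N => ?_) ?_⟩
  · exact Algebra.algebraMap_eq_smul_one (A i j)
  · exact Algebra.algebraMap_eq_smul_one (A i j)

theorem envOp {n : ℕ} {x : ∀ N : ℕ, BathMat (N + 1)} {b : B} (h : Emerges p a ad n x b) :
    MatEmerges p a ad (fun N => CentralSpin.envOp (x N)) (CentralSpin.envOp b) := by
  intro i j
  by_cases hij : i = j
  · subst hij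
    exact ⟨n, h.congr (fun _ => by simp [CentralSpin.envOp]) (by simp [CentralSpin.envOp])⟩
  · exact ⟨n, (Emerges.zero n).congr (fun _ => by simp [CentralSpin.envOp, hij])
      (by simp [CentralSpin.envOp, hij])⟩

theorem dissipator {V V' : ∀ N : ℕ, Matrix (Fin 2) (Fin 2) (BathMat (N + 1))}
    {W W' : Matrix (Fin 2) (Fin 2) B} (hV : MatEmerges p a ad V W) (hV' : MatEmerges p a ad V' W')
    (h : MatEmerges p a ad X Y) :
    MatEmerges p a ad (fun N => CentralSpin.dissipator (V N) (V' N) (X N))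
      (CentralSpin.dissipator W W' Y) :=
  ((hV'.mul h).mul hV).sub ((((hV'.mul hV).mul h).add (h.mul (hV'.mul hV))).smul (1 / 2))

theorem hamPart {H : ∀ N : ℕ, Matrix (Fin 2) (Fin 2) (BathMat (N + 1))}
    {H' : Matrix (Fin 2) (Fin 2) B} (hH : MatEmerges p a ad H H') (h : MatEmerges p a ad X Y) :
    MatEmerges p a ad (fun N => CentralSpin.hamPart (H N) (X N)) (CentralSpin.hamPart H' Y) :=
  ((hH.mul h).sub (h.mul hH)).smul Complex.I

theorem hamTau (w : Fin 3 → ℝ) :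
    MatEmerges p a ad (fun _ => CentralSpin.hamTau w) (CentralSpin.hamTau w) := by
  simp only [CentralSpin.hamTau, Fin.sum_univ_three]
  exact (((spinOp _).smul _).add ((spinOp _).smul _)).add ((spinOp _).smul _)

theorem dissTau (γd γu : ℝ) (h : MatEmerges p a ad X Y) :
    MatEmerges p a ad (fun N => CentralSpin.dissTau γd γu (X N)) (CentralSpin.dissTau γd γu Y) :=
  ((dissipator (spinOp _) (spinOp _) h).smul _).add ((dissipator (spinOp _) (spinOp _) h).smul _)

theorem lower : Emerges p a ad 1 (fun N => aN p (N + 1)) a :=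
  (Emerges.one 0).lower.congr (fun _ => (mul_one _).symm) (mul_one _).symm

theorem raise : Emerges p a ad 1 (fun N => adN p (N + 1)) ad :=
  (Emerges.one 0).raise.congr (fun _ => (mul_one _).symm) (mul_one _).symm

theorem monom (μ : MonIdx) : MatEmerges p a ad (fun N => monomN p (N + 1) μ) (CentralSpin.monom ad a (algebraMap ℂ B (-(p.ε : ℂ))) μ) := by
  have ha : ∀ k, Emerges p a ad k (fun N => aN p (N + 1) ^ k) (a ^ k) := by
    intro k
    induction k with
    | zero => exact (Emerges.one 0).congr (fun _ => pow_zero _) (pow_zero _)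
    | succ k ih => exact ih.lower.congr (fun _ => pow_succ' _ _) (pow_succ' _ _)
  have had : ∀ k, Emerges p a ad k (fun N => adN p (N + 1) ^ k) (ad ^ k) := by
    intro k
    induction k with
    | zero => exact (Emerges.one 0).congr (fun _ => pow_zero _) (pow_zero _)
    | succ k ih => exact ih.raise.congr (fun _ => pow_succ' _ _) (pow_succ' _ _)
  have hm : ∀ k, Emerges p a ad k (fun N => mz (N + 1) ^ k)
      ((algebraMap ℂ B (-(p.ε : ℂ))) ^ k) := by
    intro k
    induction k with
    | zero => exact (Emerges.one 0).congr (fun _ => pow_zero _) (pow_zero _)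
    | succ k ih =>
      exact ih.mag.congr (fun _ => pow_succ' _ _) (by rw [pow_succ', Algebra.smul_def])
  exact (spinOp _).mul (envOp (((had μ.l).mul (ha μ.k)).mul (hm μ.h)))

/-- The coupling g₀/√N is exactly the normalisation of a_N up to √ε, so the interaction is
Jaynes–Cummings in form already at finite size. -/
theorem hamInt (hp : p.Admissible) :
    MatEmerges p a ad (fun N => CentralSpin.hamInt (p.g₀ / √((N + 1 : ℕ) : ℝ)) (N + 1))
      (jaynesCummings p a ad) := by
  refine ((((spinOp raising).mul (envOp lower)).add ((spinOp lowering).mul (envOp raise))).smul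
    ((p.g₀ * √p.ε : ℝ) : ℂ)).congr (fun N => ?_) ?_
  · have he : ((√p.ε : ℝ) : ℂ) * p.invSqrtε = 1 := by
      have := hp.invSqrtε_ne_zero
      rw [Params.invSqrtε] at this ⊢
      exact mul_inv_cancel₀ fun h => this (by rw [h, inv_zero])
    have hc : ((p.g₀ / √((N + 1 : ℕ) : ℝ) : ℝ) : ℂ) =
        ((p.g₀ * √p.ε : ℝ) : ℂ) * (p.invSqrtε * invSqrt N) := by
      rw [invSqrt]
      push_cast
      linear_combination (-(p.g₀ : ℂ) * ((√((N : ℝ) + 1) : ℝ) : ℂ)⁻¹) * he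
    have henv : ∀ (c : ℂ) (x : BathMat (N + 1)),
        CentralSpin.envOp (c • x) = c • CentralSpin.envOp x := by
      intro c x
      ext i j : 2
      by_cases hij : i = j <;> simp [CentralSpin.envOp, hij]
    rw [aN_eq hp, adN_eq hp, CentralSpin.hamInt, hc, henv, henv, mul_smul_comm, mul_smul_comm,
      ← smul_add, smul_smul]
    rfl
  · rw [jaynesCummings, add_comm]

end MatEmerges

/-- Operators 1 ⊗ ν are scalar matrices over the environment algebra, which reduces the bath
dissipator to the entrywise statement. -/
theorem dissipator_envOp_apply (ν νd : B)
    (X : Matrix (Fin 2) (Fin 2) B) (i j : Fin 2) :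
    dissipator (envOp ν) (envOp νd) X i j = dissipator ν νd (X i j) := by
  simp [dissipator, envOp, Matrix.diagonal_mul, Matrix.mul_diagonal]

theorem MatEmerges.dissBath (hp : p.Admissible) (hab : ⁅a, ad⁆ = 1)
    {X : ∀ N : ℕ, Matrix (Fin 2) (Fin 2) (BathMat (N + 1))}
    {Y : Matrix (Fin 2) (Fin 2) B} (h : MatEmerges p a ad X Y) :
    MatEmerges p a ad (fun N => CentralSpin.dissBath p (N + 1) (X N))
      ((κdown p : ℂ) • CentralSpin.dissipator (CentralSpin.envOp a) (CentralSpin.envOp ad) Y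
        + (κup p : ℂ) • CentralSpin.dissipator (CentralSpin.envOp ad) (CentralSpin.envOp a) Y) := by
  intro i j
  obtain ⟨n, hn⟩ := h i j
  refine ⟨n, (hn.bathDiss hp hab).congr (fun N => ?_) ?_⟩
  · simp only [CentralSpin.dissBath, bathDiss, Matrix.sum_apply, Matrix.add_apply,
      Matrix.smul_apply, dissipator_envOp_apply]
  · simp only [bosonDiss, Matrix.add_apply, Matrix.smul_apply, dissipator_envOp_apply]

theorem MatEmerges.generator (hp : p.Admissible) (hab : ⁅a, ad⁆ = 1)
    {X : ∀ N : ℕ, Matrix (Fin 2) (Fin 2) (BathMat (N + 1))}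
    {Y : Matrix (Fin 2) (Fin 2) B} (h : MatEmerges p a ad X Y) :
    MatEmerges p a ad
      (fun N => CentralSpin.generator p (p.g₀ / √((N + 1 : ℕ) : ℝ)) (N + 1) (X N))
      (emergentGenerator p a ad Y) :=
  ((((hamTau p.w).add (hamInt hp)).hamPart h).add (h.dissTau p.γdown p.γup)).add (h.dissBath hp hab)

theorem MatEmerges.tendsto (hp : p.Admissible) (hab : ⁅a, ad⁆ = 1) {T : B → ℕ → ℂ}
    (hT : IsThermal p a ad T)
    {X : ∀ N : ℕ, Matrix (Fin 2) (Fin 2) (BathMat (N + 1))}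
    {Y : Matrix (Fin 2) (Fin 2) B} (h : MatEmerges p a ad X Y) (ρ : SpinMat) :
    Tendsto (fun N => prodState ρ (OmegaSS p (N + 1)) (X N)) atTop
      (𝓝 (prodState ρ (fun b => ∑' k, T b k) Y)) := by
  simp only [prodState, Matrix.trace, Matrix.diag_apply, Matrix.mul_apply, Matrix.map_apply]
  refine tendsto_finsetSum _ fun i _ => tendsto_finsetSum _ fun j _ => ?_
  obtain ⟨n, hn⟩ := h j i
  exact (hn.tendsto hp hab hT).2.const_mul _

end Composite

end CentralSpin

/-! ### The limit theorem -/

theorem theorem1 (p : CentralSpin.Params)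
    (hγdown : 0 ≤ p.γdown) (hγup : 0 ≤ p.γup)
    (hΓup : 0 ≤ p.Γup) (hΓ : p.Γup < p.Γdown)
    (ρ : CentralSpin.SpinMat) (hρ : ρ.PosSemidef) (hρ1 : ρ.trace = 1)
    (ν μ η : CentralSpin.MonIdx) :
    (∀ s t : Fin 2, Summable (CentralSpin.thermalTerm p
      ((CentralSpin.monomB p ν * CentralSpin.generatorB p (CentralSpin.monomB p μ) *
        CentralSpin.monomB p η) s t))) ∧
    Tendsto
      (fun N : ℕ => CentralSpin.prodState ρ (CentralSpin.OmegaSS p N)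
        (CentralSpin.monomN p N ν *
          CentralSpin.generator p (p.g₀ / √(N : ℝ)) N (CentralSpin.monomN p N μ) *
          CentralSpin.monomN p N η))
      atTop
      (𝓝 (CentralSpin.prodState ρ (CentralSpin.OmegaB p)
        (CentralSpin.monomB p ν * CentralSpin.generatorB p (CentralSpin.monomB p μ) *
          CentralSpin.monomB p η))) := by
  have hp : p.Admissible := ⟨hΓup, hΓ⟩
  have hT := CentralSpin.isThermal_thermalTerm hp
  -- The abstract algebra with [a, a†] = 1 is specialised to the Fock space operators; `monomB`,
  -- `generatorB` and `OmegaB` agree with their abstract counterparts by unfolding.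
  have h := ((CentralSpin.MatEmerges.monom (p := p) (a := CentralSpin.aB) (ad := CentralSpin.adB)
    ν).mul ((CentralSpin.MatEmerges.monom μ).generator hp CentralSpin.lie_aB_adB)).mul
      (CentralSpin.MatEmerges.monom η)
  refine ⟨fun s t => ?_,
    -- Emergence is formulated for N + 1 bath spins, which avoids the division by zero at N = 0; the
    -- shift leaves the limit unchanged.
    (tendsto_add_atTop_iff_nat 1).1 (h.tendsto hp CentralSpin.lie_aB_adB hT ρ)⟩
  obtain ⟨n, hn⟩ := h s t
  exact (hn.tendsto hp CentralSpin.lie_aB_adB hT).1
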